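/- **Setting.** Let $G=(V,E,A,\varphi)$ be a finite connected simple graph with edge lengths $A(e)>0$ and node weights $\varphi(v)>0$. Let $|G|$ be its geometric realization (each edge $e$ is a segment of length $A(e)$), with shortest-path distance $d$, let $D_G$ be the diameter of $(|G|,d)$, and let $\varphi_{\min}=\min_v\varphi(v)$. A feasible strategy of $k\ge 1$ robots is a map $\pi=(\pi_1,\dots,\pi_k):[0,\infty)\to|G|^k$ with $d(\pi_r(t),\pi_r(t'))\le|t-t'|$ for all $r,t,t'$. Put $\tau_\pi(v,t)=\max_r\sup\{t'\le t:\pi_r(t')=v\}$ (with $\sup\emptyset=0$), $L_\pi(t)=\max_v\varphi(v)\,(t-\tau_\pi(v,t))$, $J_T(\pi)=\sup_{t\ge T}L_\pi(t)\in[0,\infty]$, and let $J^*=\inf_\pi J_T(\pi)$, the infimum being over all feasible strategies with arbitrary initial positions. Fix $\tau_{\max}>0$, an initial configuration $\boldsymbol p_0\in V^k$ and a finite $T>D_G+J^*/\varphi_{\min}$. **The TWLO-MDP.** A state is $s_n=(\boldsymbol p_n,\boldsymbol L_n,z_n,\eta_n)$, where $\boldsymbol p_n$ lists for each robot $r$ a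 triple (starting node, target node, remaining duration $\delta_{n,r}$), $\boldsymbol L_n$ lists the node latencies, $z_n$ is the worst-latency tracker and $\eta_n$ the elapsed-time counter. The initial state $s_0$ has all robots available at the nodes $\boldsymbol p_0$ (remaining durations $0$), $\boldsymbol L_0=0$, $z_0=0$, $\eta_0=0$. In each state every robot with $\delta_{n,r}=0$, located at its target node $v$, either moves to a neighbour $u$ of $v$, with duration $A(vu)$, or waits at $v$ for a duration $\tau\in(0,\tau_{\max}]$; its triple is reset to $(v,\text{new target},\text{duration})$. All other robots take a no-op and continue. After this assignment let $\Delta t=\min_r\delta_{n,r}$ if $\eta_n=T$, and $\Delta t=\min(\min_r\delta_{n,r},\,T-\eta_n)$ if $\eta_n<T$. All remaining durations decrease by $\Delta t$ and $\eta_{n+1}=\min(\eta_n+\Delta t,T)$. For each node $v$, $L_{n+1,v}=0$ if $v$ is visited in $(t_n,t_{n+1}]$, that is, if a robot waits at $v$ in this step or completes its move to $v$ at time $t_{n+1}$, and $L_{n+1,v}=L_{n,v}+\Delta t$ otherwise; here $t_0=0$ and $t_{n+1}=t_n+\Delta t$. Finally $z_{n+1}=0$ if $\eta_{n+1}<T$,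 and $z_{n+1}=\max\{z_n,\max_v\varphi(v)\ell_{n,v}\}$ if $\eta_{n+1}=T$, where $\ell_{n,v}=0$ if a robot waits at $v$ during this step and $\ell_{n,v}=L_{n,v}+\Delta t$ otherwise. The reward is $R_n=z_n$. A policy is a stationary Markov (possibly randomized) policy $\mu$ choosing available joint actions such that, almost surely from $s_0$, $t_n\to\infty$ (only finitely many events occur in finite time). Its value is $$J^{\mathrm{ave}}_{s_0}(\mu)=\lim_{N\to\infty}\frac1N\sum_{n=0}^{N-1}\mathbb E_\mu[R_n\mid s_0]\in[0,\infty].$$ **Theorem (Optimality of the TWLO-MDP reformulation).** The limit defining $J^{\mathrm{ave}}_{s_0}(\mu)$ exists in $[0,\infty]$ for every policy $\mu$. There is an optimal policy $\mu^*$, and $$J^{\mathrm{ave}}_{s_0}(\mu^*)=\inf_\mu J^{\mathrm{ave}}_{s_0}(\mu)=J^*.$$ Moreover, for every optimal policy $\mu$ and almost every trajectory of $\mu$ from $s_0$, the strategy $\pi$ obtained by concatenating the motion and waiting segments prescribed by the trajectory is feasible, starts at $\boldsymbol p_0$, and satisfies $J_T(\pi)=J^*$. -/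

import Mathlib

open MeasureTheory ProbabilityTheory Filter Topology
open scoped NNReal ENNReal

noncomputable section

namespace Monitoring

/-! ## The monitoring environment -/

/-- A weighted graph with positive edge lengths and positive node weights. -/
structure Env (V : Type*) where
  /-- nodes and edges -/
  graph : SimpleGraph V
  /-- the length of each edge (only the values on edges matter) -/
  length : Sym2 V → ℝ
  /-- the priority of each node -/
  weight : V → ℝ
  length_pos : ∀ e ∈ graph.edgeSet, 0 < length e
  weight_pos : ∀ v, 0 < weight v

variable {V : Type*}

open Classical in
/-- Barycentric coordinates of the node `v`. -/
def nodeFun (v : V) : V → ℝ := fun w => if w = v then 1 else 0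

/-- Barycentric coordinates of the point of the segment from `u` to `v` that lies at the
fraction `s` of the way. -/
def edgeFun (u v : V) (s : ℝ) : V → ℝ := fun w => (1 - s) * nodeFun u w + s * nodeFun v w

/-- The geometric realization of the graph: all nodes and all points of all closed edges, given by
their barycentric coordinates. -/
def Env.Realization (M : Env V) : Type _ :=
  {x : V → ℝ // (∃ v, x = nodeFun v) ∨
    ∃ u v, M.graph.Adj u v ∧ ∃ s ∈ Set.Icc (0 : ℝ) 1, x = edgeFun u v s}

/-- The node `v` as a point of the realization. -/
def Env.node (M : Env V) (v : V) : M.Realization := ⟨nodeFun v, Or.inl ⟨v, rfl⟩⟩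

/-- The point of the edge `uv` at the fraction `s` of the way from `u` to `v`. -/
def Env.edgePoint (M : Env V) {u v : V} (h : M.graph.Adj u v) (s : Set.Icc (0 : ℝ) 1) :
    M.Realization :=
  ⟨edgeFun u v s, Or.inr ⟨u, v, h, s, s.2, rfl⟩⟩

/-- `M.PathLength x y l`: there is a path of length `l` from `x` to `y` which is a finite
concatenation of segments, each of them contained in a single closed edge. -/
inductive Env.PathLength (M : Env V) : M.Realization → M.Realization → ℝ → Prop
  | nil (x : M.Realization) : Env.PathLength M x x 0
  | cons {u v : V} (h : M.graph.Adj u v) (s s' : Set.Icc (0 : ℝ) 1) {y : M.Realization} {l : ℝ} :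
      Env.PathLength M (M.edgePoint h s') y l →
      Env.PathLength M (M.edgePoint h s) y (|(s : ℝ) - s'| * M.length s(u, v) + l)

/-- The shortest-path distance on the realization. -/
def Env.pathDist (M : Env V) (x y : M.Realization) : ℝ := sInf {l | M.PathLength x y l}

/-- The diameter of the realization. -/
def Env.diameter (M : Env V) : ℝ := ⨆ q : M.Realization × M.Realization, M.pathDist q.1 q.2

/-- The minimal node weight. -/
def Env.minWeight (M : Env V) : ℝ := ⨅ v, M.weight v

/-! ## The continuous-time monitoring problem -/

/-- A joint trajectory of `k` robots. -/
abbrev Env.Strategy (M : Env V) (k : ℕ) : Type _ := ℝ≥0 → Fin k → M.Realization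

/-- The feasible strategies: every robot moves with speed at most one. -/
def Env.feasible (M : Env V) (k : ℕ) : Set (M.Strategy k) :=
  {π | ∀ (t t' : ℝ≥0) (r : Fin k), M.pathDist (π t r) (π t' r) ≤ |(t : ℝ) - t'|}

/-- The last time up to `t` at which some robot is at `v`. For a robot which has not yet been at
`v` the inner supremum is taken over the empty set and has the value `0`. -/
def Env.lastVisit (M : Env V) {k : ℕ} (π : M.Strategy k) (v : V) (t : ℝ≥0) : ℝ≥0 :=
  ⨆ r : Fin k, sSup {t' : ℝ≥0 | t' ≤ t ∧ π t' r = M.node v}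

/-- The latency of node `v` at time `t`. -/
def Env.latency (M : Env V) {k : ℕ} (π : M.Strategy k) (v : V) (t : ℝ≥0) : ℝ :=
  (t : ℝ) - M.lastVisit π v t

/-- The instantaneous worst weighted latency (a maximum over the finitely many nodes). -/
def Env.worstLatency (M : Env V) {k : ℕ} (π : M.Strategy k) (t : ℝ≥0) : ℝ :=
  ⨆ v, M.weight v * M.latency π v t

/-- The worst weighted latency after time `T`, an element of `[0, ∞]`. -/
def Env.tailLatency (M : Env V) {k : ℕ} (T : ℝ) (π : M.Strategy k) : ℝ≥0∞ :=
  ⨆ (t : ℝ≥0) (_ : T ≤ t), ENNReal.ofReal (M.worstLatency π t)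

/-- The optimal value of the monitoring problem with `k` robots. -/
def Env.optimalTailLatency (M : Env V) (k : ℕ) (T : ℝ) : ℝ≥0∞ :=
  ⨅ π ∈ M.feasible k, M.tailLatency T π

/-! ## The event-driven decision process: states, actions and transition -/

/-- The position of a robot: starting node, target node, remaining duration of its action. -/
abbrev RobotState (V : Type*) : Type _ := V × V × ℝ

/-- The action of a robot: either the no-op (left) or the next target node and the duration
(right). -/
abbrev RobotAction (V : Type*) : Type _ := Unit ⊕ (V × ℝ)

/-- A state: positions of the robots, latencies of the nodes, the tracker of the worst weighted
latency and the elapsed-time counter. -/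
abbrev State (V : Type*) (k : ℕ) : Type _ := (Fin k → RobotState V) × (V → ℝ) × ℝ × ℝ

/-- A joint action. -/
abbrev Action (V : Type*) (k : ℕ) : Type _ := Fin k → RobotAction V

variable {k : ℕ}

/-- The positions in a state. -/
def State.pos (s : State V k) : Fin k → RobotState V := s.1

/-- The node latencies in a state. -/
def State.lat (s : State V k) : V → ℝ := s.2.1

/-- The tracker of the worst weighted latency in a state. -/
def State.tracker (s : State V k) : ℝ := s.2.2.1

/-- The elapsed-time counter in a state. -/
def State.elapsed (s : State V k) : ℝ := s.2.2.2

/-- The actions available to a robot. If its previous action is completed, it moves to a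
neighbour, which takes the length of the edge, or waits where it is for a duration in
`(0, τmax]`. Otherwise it continues (no-op). -/
def Env.robotActions (M : Env V) (τmax : ℝ) (p : RobotState V) : Set (RobotAction V) :=
  {a | (p.2.2 = 0 ∧ ∃ (v : V) (τ : ℝ), a = Sum.inr (v, τ) ∧
          ((M.graph.Adj p.2.1 v ∧ τ = M.length s(p.2.1, v)) ∨
            (v = p.2.1 ∧ 0 < τ ∧ τ ≤ τmax))) ∨
       (p.2.2 ≠ 0 ∧ a = Sum.inl ())}

/-- The joint actions available in a state. -/
def Env.actions (M : Env V) (τmax : ℝ) (s : State V k) : Set (Action V k) :=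
  {a | ∀ r, a r ∈ M.robotActions τmax (s.pos r)}

/-- The position of a robot directly after it has been assigned an action. -/
def assign (p : RobotState V) (a : RobotAction V) : RobotState V :=
  Sum.elim (fun _ => p) (fun x => (p.2.1, x.1, x.2)) a

/-- The time from a decision to the next event: the smallest remaining duration after the
assignment, cut off such that the horizon `T` is itself an event. -/
def duration (T : ℝ) (s : State V k) (a : Action V k) : ℝ :=
  let d := ⨅ r, (assign (s.pos r) (a r)).2.2
  if s.elapsed < T then min d (T - s.elapsed) else d

/-- The positions at the next event. -/
def nextPos (T : ℝ) (s : State V k) (a : Action V k) (r : Fin k) : RobotState V :=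
  ((assign (s.pos r) (a r)).1, (assign (s.pos r) (a r)).2.1,
    (assign (s.pos r) (a r)).2.2 - duration T s a)

/-- Some robot waits at the node `v` from the present to the next event. -/
def occupied (s : State V k) (a : Action V k) (v : V) : Prop :=
  ∃ r, (assign (s.pos r) (a r)).1 = v ∧ (assign (s.pos r) (a r)).2.1 = v

/-- The node `v` is visited after the present event and not later than at the next event: a robot
waits there, or a robot completes at the next event its move to `v`. -/
def visited (T : ℝ) (s : State V k) (a : Action V k) (v : V) : Prop :=
  occupied s a v ∨ ∃ r, (nextPos T s a r).2.1 = v ∧ (nextPos T s a r).2.2 = 0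

open Classical in
/-- The latency of `v` at the next event. -/
def nextLat (T : ℝ) (s : State V k) (a : Action V k) (v : V) : ℝ :=
  if visited T s a v then 0 else s.lat v + duration T s a

open Classical in
/-- The largest latency (as a left limit at the next event) that `v` reaches strictly between the
present and the next event. It is `0` if a robot is waiting at `v`. -/
def peakLat (T : ℝ) (s : State V k) (a : Action V k) (v : V) : ℝ :=
  if occupied s a v then 0 else s.lat v + duration T s a

/-- The elapsed-time counter at the next event. -/
def nextElapsed (T : ℝ) (s : State V k) (a : Action V k) : ℝ :=
  min (s.elapsed + duration T s a) T

/-- The tracker of the worst weighted latency at the next event. -/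
def Env.nextTracker (M : Env V) (T : ℝ) (s : State V k) (a : Action V k) : ℝ :=
  if nextElapsed T s a = T then max s.tracker (⨆ v, M.weight v * peakLat T s a v) else 0

/-- The deterministic transition to the state at the next event. -/
def Env.step (M : Env V) (T : ℝ) (s : State V k) (a : Action V k) : State V k :=
  (nextPos T s a, nextLat T s a, M.nextTracker T s a, nextElapsed T s a)

/-- The initial state: every robot is available at its initial node, all latencies vanish. -/
def initState (p₀ : Fin k → V) : State V k := (fun r => (p₀ r, p₀ r, 0), fun _ => 0, 0, 0)

/-! ### Measurability of the transition -/

section Policies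

variable [MeasurableSpace V]

theorem measurable_assign :
    Measurable fun q : RobotState V × RobotAction V => assign q.1 q.2 := by
  have h : (fun q : RobotState V × RobotAction V => assign q.1 q.2) =
      (Sum.elim (fun x : Unit × RobotState V => x.2)
        (fun x : (V × ℝ) × RobotState V => (x.2.2.1, x.1.1, x.1.2))) ∘
      (MeasurableEquiv.sumProdDistrib Unit (V × ℝ) (RobotState V)) ∘ Prod.swap := by
    funext ⟨p, a⟩
    rcases a with a | a <;> rfl
  rw [h]
  refine Measurable.comp ?_ ((MeasurableEquiv.measurable _).comp measurable_swap)
  exact Measurable.sumElim (by fun_prop) (by fun_prop)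

theorem measurable_assign_coord (r : Fin k) :
    Measurable fun x : State V k × Action V k => assign (x.1.pos r) (x.2 r) := by
  have h : Measurable fun x : State V k × Action V k => (x.1.1 r, x.2 r) := by fun_prop
  exact measurable_assign.comp h

theorem measurable_duration (T : ℝ) :
    Measurable fun x : State V k × Action V k => duration T x.1 x.2 := by
  have hd : Measurable fun x : State V k × Action V k =>
      ⨅ r, (assign (x.1.pos r) (x.2 r)).2.2 :=
    Measurable.iInf fun r => (measurable_assign_coord r).snd.snd
  have he : Measurable fun x : State V k × Action V k => x.1.elapsed := by
    unfold State.elapsed; fun_prop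
  exact Measurable.ite (measurableSet_lt he measurable_const)
    (hd.min (measurable_const.sub he)) hd

theorem measurable_nextPos (T : ℝ) (r : Fin k) :
    Measurable fun x : State V k × Action V k => nextPos T x.1 x.2 r :=
  (measurable_assign_coord r).fst.prodMk ((measurable_assign_coord r).snd.fst.prodMk
    ((measurable_assign_coord r).snd.snd.sub (measurable_duration T)))

theorem measurable_lat_add (T : ℝ) (v : V) :
    Measurable fun x : State V k × Action V k => x.1.lat v + duration T x.1 x.2 := by
  have h : Measurable fun x : State V k × Action V k => x.1.lat v := by
    unfold State.lat; fun_prop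
  exact h.add (measurable_duration T)

theorem measurable_nextElapsed (T : ℝ) :
    Measurable fun x : State V k × Action V k => nextElapsed T x.1 x.2 := by
  have he : Measurable fun x : State V k × Action V k => x.1.elapsed := by
    unfold State.elapsed; fun_prop
  exact (he.add (measurable_duration T)).min measurable_const

variable [Finite V] [DiscreteMeasurableSpace V]

theorem measurableSet_occupied (v : V) :
    MeasurableSet {x : State V k × Action V k | occupied x.1 x.2 v} := by
  simp only [occupied, Set.ofPred_exists]
  exact MeasurableSet.iUnion fun r =>
    ((measurable_assign_coord r).fst (measurableSet_singleton v)).inter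
      ((measurable_assign_coord r).snd.fst (measurableSet_singleton v))

theorem measurableSet_visited (T : ℝ) (v : V) :
    MeasurableSet {x : State V k × Action V k | visited T x.1 x.2 v} := by
  refine (measurableSet_occupied v).union ?_
  change MeasurableSet {x : State V k × Action V k |
    ∃ r, (nextPos T x.1 x.2 r).2.1 = v ∧ (nextPos T x.1 x.2 r).2.2 = 0}
  simp only [Set.ofPred_exists]
  exact MeasurableSet.iUnion fun r =>
    ((measurable_nextPos T r).snd.fst (measurableSet_singleton v)).inter
      ((measurable_nextPos T r).snd.snd (measurableSet_singleton 0))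

theorem Env.measurable_nextTracker (M : Env V) (T : ℝ) :
    Measurable fun x : State V k × Action V k => M.nextTracker T x.1 x.2 := by
  have ht : Measurable fun x : State V k × Action V k => x.1.tracker := by
    unfold State.tracker; fun_prop
  refine Measurable.ite ((measurable_nextElapsed T) (measurableSet_singleton T))
    (ht.max (Measurable.iSup fun v => Measurable.const_mul ?_ _)) measurable_const
  exact Measurable.ite (measurableSet_occupied v) measurable_const (measurable_lat_add T v)

theorem Env.measurable_step (M : Env V) (T : ℝ) :
    Measurable fun x : State V k × Action V k => M.step T x.1 x.2 := by
  refine (measurable_pi_lambda _ fun r => measurable_nextPos T r).prodMk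
    ((measurable_pi_lambda _ fun v => ?_).prodMk
      ((M.measurable_nextTracker T).prodMk (measurable_nextElapsed T)))
  exact Measurable.ite (measurableSet_visited T v) measurable_const (measurable_lat_add T v)

/-! ## Policies and the average-reward criterion -/

/-- A stationary Markov policy, possibly randomized: in every state it picks an available joint
action, with a distribution that depends on the current state only. -/
structure Env.Policy (M : Env V) (k : ℕ) (τmax : ℝ) where
  /-- the distribution of the joint action in each state -/
  kernel : Kernel (State V k) (Action V k)
  isMarkov : IsMarkovKernel kernel
  available : ∀ s, ∀ᵐ a ∂(kernel s), a ∈ M.actions τmax s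

/-- The law of the next state-action pair, given the present state-action pair. -/
def Env.Policy.pairKernel {M : Env V} {τmax : ℝ} (μ : M.Policy k τmax) (T : ℝ) :
    Kernel (State V k × Action V k) (State V k × Action V k) :=
  (Kernel.id ×ₖ μ.kernel).comap (fun x => M.step T x.1 x.2) (M.measurable_step T)

/-- The law of the next state-action pair, given the history. -/
def Env.Policy.historyKernel {M : Env V} {τmax : ℝ} (μ : M.Policy k τmax) (T : ℝ) (n : ℕ) :
    Kernel (Π _ : Finset.Iic n, State V k × Action V k) (State V k × Action V k) :=
  (μ.pairKernel T).comap (fun h => h ⟨n, Finset.mem_Iic.2 le_rfl⟩) (measurable_pi_apply _)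

instance Env.Policy.isMarkovKernel_historyKernel {M : Env V} {τmax : ℝ} (μ : M.Policy k τmax)
    (T : ℝ) (n : ℕ) : IsMarkovKernel (μ.historyKernel T n) := by
  have := μ.isMarkov
  unfold Env.Policy.historyKernel Env.Policy.pairKernel
  infer_instance

/-- The law of the trajectory of state-action pairs under the policy `μ` from the state `s₀`. -/
def Env.Policy.law {M : Env V} {τmax : ℝ} (μ : M.Policy k τmax) (T : ℝ) (s₀ : State V k) :
    Measure (ℕ → State V k × Action V k) :=
  Kernel.trajMeasure (X := fun _ => State V k × Action V k)
    ((Kernel.id ×ₖ μ.kernel) s₀) (μ.historyKernel T)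

/-- The physical time of the `n`-th event of a trajectory. -/
def eventTime (T : ℝ) (ξ : ℕ → State V k × Action V k) (n : ℕ) : ℝ :=
  ∑ i ∈ Finset.range n, duration T (ξ i).1 (ξ i).2

/-- The admissible policies: almost surely, only finitely many events occur in finite time, so
that trajectories describe the system for all times. -/
def Env.admissible (M : Env V) (τmax T : ℝ) (s₀ : State V k) : Set (M.Policy k τmax) :=
  {μ | ∀ᵐ ξ ∂(μ.law T s₀), Tendsto (eventTime T ξ) atTop atTop}

/-- The reward `R(s, a)`. -/
def reward (s : State V k) (_a : Action V k) : ℝ := s.tracker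

/-- The expected mean reward over the first `N` decision steps, an element of `[0, ∞]`. -/
def Env.Policy.meanReward {M : Env V} {τmax : ℝ} (μ : M.Policy k τmax) (T : ℝ) (s₀ : State V k)
    (N : ℕ) : ℝ≥0∞ :=
  (N : ℝ≥0∞)⁻¹ * ∑ n ∈ Finset.range N,
    ∫⁻ ξ, ENNReal.ofReal (reward (ξ n).1 (ξ n).2) ∂(μ.law T s₀)

/-- The average reward (written as an upper limit, so that it is defined for every policy). -/
def Env.Policy.averageReward {M : Env V} {τmax : ℝ} (μ : M.Policy k τmax) (T : ℝ)
    (s₀ : State V k) : ℝ≥0∞ :=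
  limsup (μ.meanReward T s₀) atTop

end Policies

/-! ## The monitoring strategy described by a trajectory -/

theorem edgeFraction_mem {len ρ : ℝ} (h : 0 ≤ ρ ∧ ρ ≤ len) :
    1 - ρ / len ∈ Set.Icc (0 : ℝ) 1 := by
  have h1 : ρ / len ≤ 1 := div_le_one_of_le₀ h.2 (h.1.trans h.2)
  have h2 : 0 ≤ ρ / len := div_nonneg h.1 (h.1.trans h.2)
  exact ⟨by linarith, by linarith⟩

open Classical in
/-- The point of the realization which a robot state describes: on the edge from the starting
node to the target node, at a distance from the target equal to the remaining duration; the target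
node itself if the robot is waiting. -/
def Env.point (M : Env V) (p : RobotState V) : M.Realization :=
  if h : M.graph.Adj p.1 p.2.1 ∧ 0 ≤ p.2.2 ∧ p.2.2 ≤ M.length s(p.1, p.2.1) then
    M.edgePoint h.1 ⟨1 - p.2.2 / M.length s(p.1, p.2.1), edgeFraction_mem h.2⟩
  else M.node p.2.1

/-- The strategy described by a trajectory: at time `t`, the last event is the one with number
`n = max {n | eventTime n ≤ t}`, and since then every robot has carried out for the time
`t - eventTime n` the motion or waiting segment it was in directly after that decision. -/
def Env.trajectoryStrategy (M : Env V) (T : ℝ) (ξ : ℕ → State V k × Action V k) :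
    M.Strategy k := fun t r =>
  let n := sSup {n : ℕ | eventTime T ξ n ≤ t}
  let p := assign ((ξ n).1.pos r) ((ξ n).2 r)
  M.point (p.1, p.2.1, p.2.2 - ((t : ℝ) - eventTime T ξ n))

end Monitoring

end

open Monitoring

namespace Monitoring

/-! ## Geometry of the realization -/

section Geometry

variable {V : Type*} {M : Env V}

/-! The tracker vanishes before the horizon and is a running maximum from then on, so it is monotone
along every trajectory. By monotone convergence the Cesàro means of its expectations tend to the
expectation of its supremum (`Env.Policy.averageReward_eq`); an average-reward problem thus becomes
one about single trajectories.

The lower bound is pathwise. Almost every trajectory of an admissible policy describes a feasible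
strategy, whose worst latency after `T` is at most the supremum of the tracker
(`Env.IsTrajectory.tailLatency_le`). Hence the optimal value bounds every average reward from below.
If a policy attains it, the supremum of the tracker is almost surely equal to it, and the latency of
the strategy is squeezed in between.

For the upper bound, only the visit times of a minimizing sequence of strategies are passed to a
limit, along an ultrafilter, not the strategies themselves. The limit sets are closed, compatible
with unit speed, and meet every window of length `J* / φ(v)` that ends after `T`
(`Env.exists_mem_limitVisits`). The slack in the hypothesis on `T` allows them to be moved to
slightly earlier times: the required visits remain reachable from `p₀`, and the latency bound starts
strictly before `T`. The latter matters because the tracker records left limits at events, possibly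
at `T` itself. A greedy rule turns the visits of each robot into moves and waits
(`Env.exists_schedule`): stay while all visits have slack, follow a shortest path once one has none
left. The schedules are merged into a trajectory of the decision process
(`Env.exists_isTrajectory`).

That trajectory may act differently on two visits to the same state. Loop erasure repairs this
(`Env.IsTrajectory.exists_stationary`): in every state the action of its first occurrence is used,
which gives a deterministic stationary policy that meets no new state-action pairs, so the tracker
bound survives. -/

theorem Env.edge_pos {u v : V} (h : M.graph.Adj u v) : 0 < M.length s(u, v) :=
  M.length_pos _ h

theorem edgeFun_zero (u v : V) : edgeFun u v 0 = nodeFun u := by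
  funext w; simp [edgeFun]

theorem edgeFun_one (u v : V) : edgeFun u v 1 = nodeFun v := by
  funext w; simp [edgeFun]

theorem Env.edgePoint_eq_left {u v : V} (h : M.graph.Adj u v) {s : Set.Icc (0 : ℝ) 1}
    (hs : (s : ℝ) = 0) : M.edgePoint h s = M.node u :=
  Subtype.ext (by simp [Env.edgePoint, Env.node, hs, edgeFun_zero])

theorem Env.edgePoint_eq_right {u v : V} (h : M.graph.Adj u v) {s : Set.Icc (0 : ℝ) 1}
    (hs : (s : ℝ) = 1) : M.edgePoint h s = M.node v :=
  Subtype.ext (by simp [Env.edgePoint, Env.node, hs, edgeFun_one])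

theorem nodeFun_injective : Function.Injective (nodeFun : V → V → ℝ) := by
  intro u v h
  by_contra hne
  have := congrFun h u
  simp [nodeFun, hne] at this

theorem Env.node_injective : Function.Injective M.node := fun _ _ h =>
  nodeFun_injective (congrArg Subtype.val h)

/-- An interior point of an edge is not a node. -/
theorem Env.edgePoint_ne_node {u v : V} (h : M.graph.Adj u v) {s : Set.Icc (0 : ℝ) 1}
    (h0 : (0 : ℝ) < s) (h1 : (s : ℝ) < 1) (w : V) : M.edgePoint h s ≠ M.node w := by
  intro heq
  have hf : edgeFun u v s = nodeFun w := congrArg Subtype.val heq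
  have hne := h.ne
  have hu := congrFun hf u
  have hv := congrFun hf v
  simp only [edgeFun, nodeFun, hne, hne.symm, if_true, if_false] at hu hv
  split_ifs at hu hv <;> first | (subst_vars; exact hne rfl) | linarith

theorem Env.PathLength.nonneg {x y : M.Realization} {l : ℝ} (h : M.PathLength x y l) : 0 ≤ l := by
  induction h with
  | nil => exact le_rfl
  | cons h s s' _ ih =>
    have := M.edge_pos h
    positivity

theorem Env.PathLength.trans {x y z : M.Realization} {l l' : ℝ} (h : M.PathLength x y l)
    (h' : M.PathLength y z l') : M.PathLength x z (l + l') := by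
  induction h with
  | nil => simpa using h'
  | cons h s s' _ ih => rw [add_assoc]; exact .cons h s s' (ih h')

theorem Env.PathLength.segment {u v : V} (h : M.graph.Adj u v) (s s' : Set.Icc (0 : ℝ) 1) :
    M.PathLength (M.edgePoint h s) (M.edgePoint h s') (|(s : ℝ) - s'| * M.length s(u, v)) := by
  simpa using Env.PathLength.cons h s s' (.nil _)

theorem Env.PathLength.symm {x y : M.Realization} {l : ℝ} (h : M.PathLength x y l) :
    M.PathLength y x l := by
  induction h with
  | nil => exact .nil _
  | cons h s s' _ ih =>
    rw [add_comm, abs_sub_comm]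
    exact ih.trans (.segment h s' s)

theorem Env.pathDist_nonneg (x y : M.Realization) : 0 ≤ M.pathDist x y :=
  Real.sInf_nonneg fun _ h => Env.PathLength.nonneg h

theorem Env.pathDist_le {x y : M.Realization} {l : ℝ} (h : M.PathLength x y l) :
    M.pathDist x y ≤ l :=
  csInf_le ⟨0, fun _ h => Env.PathLength.nonneg h⟩ h

theorem Env.pathDist_self (x : M.Realization) : M.pathDist x x = 0 :=
  le_antisymm (Env.pathDist_le (.nil x)) (Env.pathDist_nonneg x x)

theorem Env.pathDist_comm (x y : M.Realization) : M.pathDist x y = M.pathDist y x := by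
  unfold Env.pathDist
  congr 1
  ext l
  exact ⟨.symm, .symm⟩

theorem Env.pathDist_edgePoint_le {u v : V} (h : M.graph.Adj u v) (s s' : Set.Icc (0 : ℝ) 1) :
    M.pathDist (M.edgePoint h s) (M.edgePoint h s') ≤ |(s : ℝ) - s'| * M.length s(u, v) :=
  Env.pathDist_le (.segment h s s')

theorem Env.PathLength.edge {u v : V} (h : M.graph.Adj u v) :
    M.PathLength (M.node u) (M.node v) (M.length s(u, v)) := by
  have := Env.PathLength.segment h ⟨0, by simp⟩ ⟨1, by simp⟩
  rwa [M.edgePoint_eq_left h rfl, M.edgePoint_eq_right h rfl, zero_sub, abs_neg, abs_one,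
    one_mul] at this

theorem Env.pathDist_edge_le {u v : V} (h : M.graph.Adj u v) :
    M.pathDist (M.node u) (M.node v) ≤ M.length s(u, v) := Env.pathDist_le (.edge h)

theorem Env.exists_pathLength_node (hc : M.graph.Connected) (u v : V) :
    ∃ l, M.PathLength (M.node u) (M.node v) l := by
  obtain ⟨p⟩ := hc.preconnected u v
  induction p with
  | nil => exact ⟨0, .nil _⟩
  | cons h _ ih =>
    obtain ⟨l, hl⟩ := ih
    exact ⟨_, (Env.PathLength.edge h).trans hl⟩

theorem Env.exists_pathLength_to_node (x : M.Realization) :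
    ∃ (v : V) (l : ℝ), M.PathLength x (M.node v) l ∧ (l = 0 ∨ ∃ e, l ≤ |M.length e|) := by
  obtain ⟨x, ⟨v, rfl⟩ | ⟨u, v, h, s, hs, rfl⟩⟩ := x
  · exact ⟨v, 0, .nil _, Or.inl rfl⟩
  · refine ⟨u, |s - 0| * M.length s(u, v), ?_, Or.inr ⟨s(u, v), ?_⟩⟩
    · have := Env.PathLength.segment h ⟨s, hs⟩ ⟨0, by simp⟩
      rwa [M.edgePoint_eq_left h (s := ⟨0, by simp⟩) rfl] at this
    · rw [sub_zero, abs_of_nonneg hs.1, abs_of_pos (M.edge_pos h)]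
      exact mul_le_of_le_one_left (M.edge_pos h).le hs.2

theorem Env.exists_pathLength (hc : M.graph.Connected) (x y : M.Realization) :
    ∃ l, M.PathLength x y l := by
  obtain ⟨u, a, ha, -⟩ := Env.exists_pathLength_to_node x
  obtain ⟨v, b, hb, -⟩ := Env.exists_pathLength_to_node y
  obtain ⟨l, hl⟩ := Env.exists_pathLength_node hc u v
  exact ⟨_, (ha.trans hl).trans hb.symm⟩

theorem Env.pathDist_triangle (hc : M.graph.Connected) (x y z : M.Realization) :
    M.pathDist x z ≤ M.pathDist x y + M.pathDist y z := by
  refine le_of_forall_pos_le_add fun ε hε => ?_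
  obtain ⟨a, ha, ha'⟩ := exists_lt_of_csInf_lt (s := {l | M.PathLength x y l})
    (M.exists_pathLength hc x y) (lt_add_of_pos_right (M.pathDist x y) (half_pos hε))
  obtain ⟨b, hb, hb'⟩ := exists_lt_of_csInf_lt (s := {l | M.PathLength y z l})
    (M.exists_pathLength hc y z) (lt_add_of_pos_right (M.pathDist y z) (half_pos hε))
  have := M.pathDist_le (Env.PathLength.trans ha hb)
  linarith

/-- Every point lies within one edge length of a node, and there are finitely many edges and nodes.
This boundedness is what makes the supremum in `Env.diameter` genuine instead of a default value. -/
theorem Env.pathDist_le_diameter [Finite V] (hc : M.graph.Connected) (x y : M.Realization) :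
    M.pathDist x y ≤ M.diameter := by
  obtain ⟨A, hA⟩ := (Set.finite_range fun e => |M.length e|).bddAbove
  obtain ⟨B, hB⟩ :=
    (Set.finite_range fun q : V × V => M.pathDist (M.node q.1) (M.node q.2)).bddAbove
  have hnode : ∀ z : M.Realization, ∃ v, M.pathDist z (M.node v) ≤ max A 0 := by
    intro z
    obtain ⟨v, l, hl, rfl | ⟨e, he⟩⟩ := M.exists_pathLength_to_node z
    · exact ⟨v, (M.pathDist_le hl).trans (le_max_right _ _)⟩
    · exact ⟨v, (M.pathDist_le hl).trans ((he.trans (hA ⟨e, rfl⟩)).trans (le_max_left _ _))⟩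
  refine le_ciSup (f := fun q : M.Realization × M.Realization => M.pathDist q.1 q.2)
    ⟨max A 0 + B + max A 0, ?_⟩ (x, y)
  rintro _ ⟨⟨x, y⟩, rfl⟩
  obtain ⟨u, hu⟩ := hnode x
  obtain ⟨v, hv⟩ := hnode y
  have h1 := M.pathDist_triangle hc x (M.node u) y
  have h2 := M.pathDist_triangle hc (M.node u) (M.node v) y
  have h3 := hB ⟨(u, v), rfl⟩
  rw [M.pathDist_comm] at hv
  simp only at h3 ⊢
  linarith

/-- A function on the nodes which is 1-Lipschitz along edges is 1-Lipschitz for the path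
distance (it extends linearly to the edges). -/
theorem Env.sub_le_pathDist [Finite V] (hc : M.graph.Connected) {F : V → ℝ}
    (hF : ∀ a b, M.graph.Adj a b → F a - F b ≤ M.length s(a, b)) (v u : V) :
    F v - F u ≤ M.pathDist (M.node v) (M.node u) := by
  classical
  have := Fintype.ofFinite V
  -- In barycentric coordinates the extension of `F` is `x ↦ ∑ i, x i * F i`; it is affine on each
  -- edge, so a path changes it by at most its length.
  have hn : ∀ w, ∑ i, nodeFun w i * F i = F w := by
    intro w; simp [nodeFun]
  have he : ∀ a b s, ∑ i, edgeFun a b s i * F i = (1 - s) * F a + s * F b := by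
    intro a b s
    simp only [edgeFun, add_mul, mul_assoc, Finset.sum_add_distrib, ← Finset.mul_sum, hn]
  have key : ∀ x y l, M.PathLength x y l →
      ∑ i, x.1 i * F i - ∑ i, y.1 i * F i ≤ l := by
    intro x y l h
    induction h with
    | nil => simp
    | @cons a b h s s' y l _ ih =>
      have h1 := hF a b h
      have h2 := hF b a h.symm
      rw [Sym2.eq_swap] at h2
      simp only [Env.edgePoint, he] at ih ⊢
      have h3 : ((s' : ℝ) - s) * (F a - F b) ≤ |(s : ℝ) - s'| * M.length s(a, b) := by
        calc _ ≤ |((s' : ℝ) - s) * (F a - F b)| := le_abs_self _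
          _ = |(s : ℝ) - s'| * |F a - F b| := by rw [abs_mul, abs_sub_comm]
          _ ≤ _ := by gcongr; exact abs_le.2 ⟨by linarith, h1⟩
      linarith
  refine le_csInf (M.exists_pathLength hc _ _) fun l hl => ?_
  simpa [Env.node, hn] using key _ _ _ hl

/-- The first edge of a shortest path between different nodes. -/
theorem Env.exists_adj_pathDist_le [Finite V] (hc : M.graph.Connected) {u v : V} (huv : u ≠ v) :
    ∃ w, M.graph.Adj v w ∧ M.length s(v, w) + M.pathDist (M.node w) (M.node u) ≤
      M.pathDist (M.node v) (M.node u) := by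
  classical
  by_contra! hcon
  -- If every first edge is a strict detour, finiteness gives a common excess `ε` (the `+ 1` at
  -- non-neighbours is a dummy value). Raising the distance to `u` by `ε` at `v` alone keeps it
  -- 1-Lipschitz along edges, against `Env.sub_le_pathDist`.
  obtain ⟨ε, hε, h⟩ := Pi.exists_forall_pos_add_lt
    (x := fun _ : V => M.pathDist (M.node v) (M.node u))
    (y := fun w => if M.graph.Adj v w then M.length s(v, w) + M.pathDist (M.node w) (M.node u)
      else M.pathDist (M.node v) (M.node u) + 1)
    (by intro w; split_ifs with hw; exacts [hcon w hw, lt_add_one _])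
  have := M.sub_le_pathDist hc
    (F := fun a => M.pathDist (M.node a) (M.node u) + if a = v then ε else 0) (fun a b hab => by
      have h1 := M.pathDist_triangle hc (M.node a) (M.node b) (M.node u)
      have h2 := M.pathDist_edge_le hab
      split_ifs with ha hb hb
      · linarith
      · subst ha
        have := h b
        simp only [hab, if_true] at this
        linarith
      · linarith
      · linarith) v u
  simp [huv, M.pathDist_self] at this
  linarith

end Geometry

/-! ## Schedules of a single robot -/

section Schedule

variable {V : Type*} {M : Env V}

/-- The distance of two nodes. -/
noncomputable def Env.nodeDist (M : Env V) (u v : V) : ℝ := M.pathDist (M.node u) (M.node v)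

/-- A robot at `u` may move or wait for the duration `τ`, after which it is at `v`. -/
def Env.IsMove (M : Env V) (τmax : ℝ) (u v : V) (τ : ℝ) : Prop :=
  (M.graph.Adj u v ∧ τ = M.length s(u, v)) ∨ (v = u ∧ 0 < τ ∧ τ ≤ τmax)

theorem Env.IsMove.pos {τmax : ℝ} {u v : V} {τ : ℝ} (h : M.IsMove τmax u v τ) : 0 < τ := by
  obtain ⟨h, rfl⟩ | h := h
  exacts [M.edge_pos h, h.2.1]

/-- The sequence of moves and waits of a single robot: it completes the move number `j` at the
time `time (j + 1)`, at the node `node (j + 1)`. -/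
structure Env.Schedule (M : Env V) (τmax : ℝ) where
  /-- the node reached by the first `j` moves -/
  node : ℕ → V
  /-- the time at which the first `j` moves are completed -/
  time : ℕ → ℝ
  time_zero : time 0 = 0
  isMove : ∀ j, M.IsMove τmax (node j) (node (j + 1)) (time (j + 1) - time j)
  tendsto : Tendsto time atTop atTop

/-- The robot is at `v` at the time `t`. -/
def Env.Schedule.IsAt {τmax : ℝ} (σ : M.Schedule τmax) (v : V) (t : ℝ) : Prop :=
  ∃ j, σ.time j ≤ t ∧ t < σ.time (j + 1) ∧ σ.node j = v ∧
    (t = σ.time j ∨ σ.node (j + 1) = σ.node j)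

theorem Env.Schedule.strictMono {τmax : ℝ} (σ : M.Schedule τmax) : StrictMono σ.time :=
  strictMono_nat_of_lt_succ fun j => by linarith [(σ.isMove j).pos]

theorem exists_le_lt_succ {f : ℕ → ℝ} (hf : Tendsto f atTop atTop) {t : ℝ} (h0 : f 0 ≤ t) :
    ∃ j, f j ≤ t ∧ t < f (j + 1) := by
  by_contra! h
  have hle : ∀ j, f j ≤ t := fun j => by
    induction j with
    | zero => exact h0
    | succ j ih => exact h j ih
  obtain ⟨j, hj⟩ := (hf.eventually_gt_atTop t).exists
  exact (hle j).not_gt hj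

theorem eq_of_le_of_lt_succ {f : ℕ → ℝ} (hf : StrictMono f) {i j : ℕ} {t : ℝ}
    (hi : f i ≤ t) (hi' : t < f (i + 1)) (hj : f j ≤ t) (hj' : t < f (j + 1)) : i = j := by
  have h1 := hf.lt_iff_lt.1 (hi.trans_lt hj')
  have h2 := hf.lt_iff_lt.1 (hj.trans_lt hi')
  omega

theorem Env.nodeDist_self (v : V) : M.nodeDist v v = 0 := M.pathDist_self _

theorem Env.nodeDist_nonneg (u v : V) : 0 ≤ M.nodeDist u v := M.pathDist_nonneg _ _

/-- From `v` at the time `t` one can be in time for every prescribed visit from then on. -/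
def Env.InTime (M : Env V) (Y : V → Set ℝ) (v : V) (t : ℝ) : Prop :=
  ∀ u, ∀ t' ∈ Y u, t ≤ t' → M.nodeDist v u ≤ t' - t

/-- A robot at `v` at the time `t` has to leave in order to be in time for a prescribed visit. -/
def Env.MustLeave (M : Env V) (Y : V → Set ℝ) (v : V) (t : ℝ) : Prop :=
  ∃ u, u ≠ v ∧ t + M.nodeDist v u ∈ Y u

/-- One step of the greedy rule. If a visit has no slack left, the robot takes the first edge
towards the nearest such node; otherwise it waits for `τ₀` or until the first slack runs out. The
last two clauses prevent accumulation of steps: one shorter than `τ₀` ends where leaving is forced,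
and a forced step lasts at least `τ₀`. -/
theorem Env.InTime.exists_move [Finite V] (hc : M.graph.Connected) {τmax τ₀ : ℝ} (hτ₀ : 0 < τ₀)
    (hmax : τ₀ ≤ τmax) (hedge : ∀ u v, M.graph.Adj u v → τ₀ ≤ M.length s(u, v))
    {Y : V → Set ℝ} (hclosed : ∀ v, IsClosed (Y v))
    (hlip : ∀ u u', ∀ t ∈ Y u, ∀ t' ∈ Y u', M.nodeDist u u' ≤ |t - t'|)
    {v : V} {t : ℝ} (h : M.InTime Y v t) :
    ∃ v' τ, M.IsMove τmax v v' τ ∧ M.InTime Y v' (t + τ) ∧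
      (∀ u, ∀ t' ∈ Y u, t ≤ t' → t' < t + τ → v = u ∧ (t' = t ∨ v' = v)) ∧
      (τ₀ ≤ τ ∨ M.MustLeave Y v' (t + τ)) ∧ (M.MustLeave Y v t → τ₀ ≤ τ) := by
  have tri : ∀ a b c, M.nodeDist a c ≤ M.nodeDist a b + M.nodeDist b c := fun a b c =>
    M.pathDist_triangle hc _ _ _
  by_cases hl : M.MustLeave Y v t
  · obtain ⟨u, ⟨hu, huY⟩, hmin⟩ := Set.exists_min_image {u | u ≠ v ∧ t + M.nodeDist v u ∈ Y u}
      (M.nodeDist v) (Set.toFinite _) hl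
    obtain ⟨w, hw, hwle⟩ := M.exists_adj_pathDist_le hc hu
    change _ + M.nodeDist w u ≤ M.nodeDist v u at hwle
    have hlen := M.edge_pos hw
    -- By the Lipschitz bound, a visit to `u'` preceding that to `u` has no slack either, so `u'`
    -- would be nearer than `u`; the minimal choice of `u` leaves only `u' = v` and `t' = t`.
    have hfirst : ∀ u', ∀ t' ∈ Y u', t ≤ t' → t' < t + M.nodeDist v u → v = u' ∧ t' = t := by
      intro u' t' ht' hle hlt
      have h1 := h u' t' ht' hle
      have h2 := hlip _ _ _ ht' _ huY
      rw [abs_of_neg (by linarith)] at h2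
      have h3 := tri v u' u
      have h4 : t' = t + M.nodeDist v u' := by linarith
      have h5 : v = u' := by
        by_contra hne
        have := hmin u' ⟨Ne.symm hne, h4 ▸ ht'⟩
        linarith
      subst h5
      exact ⟨rfl, by rw [h4, M.nodeDist_self, add_zero]⟩
    have hpos := M.nodeDist_nonneg w u
    refine ⟨w, M.length s(v, w), Or.inl ⟨hw, rfl⟩, fun u' t' ht' hle => ?_,
      fun u' t' ht' hle hlt => ?_, Or.inl (hedge _ _ hw), fun _ => hedge _ _ hw⟩
    · rcases lt_or_ge t' (t + M.nodeDist v u) with hlt | hge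
      · have := (hfirst u' t' ht' (by linarith) hlt).2
        linarith
      · have h2 := hlip _ _ _ huY _ ht'
        rw [abs_of_nonpos (by linarith)] at h2
        have h3 := tri w u u'
        linarith
    · obtain ⟨h1, h2⟩ := hfirst u' t' ht' hle (by linarith)
      exact ⟨h1, Or.inl h2⟩
  -- The waiting times after which some visit elsewhere has no slack left; the last condition keeps
  -- only visits from `t` on. As `B` is closed, its infimum is attained, so after waiting that long
  -- the robot must indeed leave.
  · let B : Set ℝ := {x | ∃ u, u ≠ v ∧ x + t + M.nodeDist v u ∈ Y u ∧ 0 ≤ x + M.nodeDist v u}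
    have hB0 : ∀ x ∈ B, 0 < x := by
      rintro x ⟨u, hu, hx, hx0⟩
      have := h u _ hx (by linarith)
      refine lt_of_le_of_ne (by linarith) ?_
      rintro rfl
      exact hl ⟨u, hu, by simpa using hx⟩
    have hBc : IsClosed B := by
      have : B = ⋃ u ∈ {u | u ≠ v},
          ((fun x => x + t + M.nodeDist v u) ⁻¹' Y u ∩ {x | 0 ≤ x + M.nodeDist v u}) := by
        ext x; simp [B, and_left_comm]
      rw [this]
      refine (Set.toFinite _).isClosed_biUnion fun u _ => ?_
      exact ((hclosed u).preimage (by fun_prop)).inter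
        (isClosed_le continuous_const (by fun_prop))
    have hwait : ∀ τ, 0 < τ → τ ≤ τ₀ → (∀ x ∈ B, τ ≤ x) → M.IsMove τmax v v τ ∧
        M.InTime Y v (t + τ) ∧
        (∀ u, ∀ t' ∈ Y u, t ≤ t' → t' < t + τ → v = u ∧ (t' = t ∨ v = v)) := by
      intro τ h0 h1 hB
      have hB' : ∀ u, ∀ t' ∈ Y u, t ≤ t' → u ≠ v → τ ≤ t' - t - M.nodeDist v u :=
        fun u t' ht' hle hu => hB _ ⟨u, hu, by ring_nf; exact ht', by linarith⟩
      refine ⟨Or.inr ⟨rfl, h0, h1.trans hmax⟩, fun u t' ht' hle => ?_,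
        fun u t' ht' hle hlt => ⟨?_, Or.inr rfl⟩⟩
      · rcases eq_or_ne u v with rfl | hu
        · rw [M.nodeDist_self]; linarith
        · linarith [hB' u t' ht' (by linarith) hu]
      · by_contra hu
        linarith [hB' u t' ht' hle (Ne.symm hu), M.nodeDist_nonneg v u]
    by_cases hB : ∀ x ∈ B, τ₀ ≤ x
    · obtain ⟨h1, h2, h3⟩ := hwait τ₀ hτ₀ le_rfl hB
      exact ⟨v, τ₀, h1, h2, h3, Or.inl le_rfl, fun hl' => (hl hl').elim⟩
    · push Not at hB
      obtain ⟨x, hx, hxτ⟩ := hB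
      have hbdd : BddBelow B := ⟨0, fun y hy => (hB0 y hy).le⟩
      have hmem : sInf B ∈ B := hBc.csInf_mem ⟨x, hx⟩ hbdd
      obtain ⟨h1, h2, h3⟩ := hwait (sInf B) (hB0 _ hmem) ((csInf_le hbdd hx).trans hxτ.le)
        fun y hy => csInf_le hbdd hy
      refine ⟨v, sInf B, h1, h2, h3, Or.inr ?_, fun hl' => (hl hl').elim⟩
      obtain ⟨u, hu, hY, -⟩ := hmem
      exact ⟨u, hu, by rwa [add_comm t]⟩

/-- A robot can pay all visits of a closed set of prescribed visits, if they are 1-Lipschitz. -/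
theorem Env.exists_schedule [Finite V] (hc : M.graph.Connected) {τmax : ℝ} (hτ : 0 < τmax)
    {Y : V → Set ℝ} (hclosed : ∀ v, IsClosed (Y v))
    (hlip : ∀ u u', ∀ t ∈ Y u, ∀ t' ∈ Y u', M.nodeDist u u' ≤ |t - t'|)
    {v₀ : V} (h : M.InTime Y v₀ 0) :
    ∃ σ : M.Schedule τmax, σ.node 0 = v₀ ∧ ∀ v, ∀ t ∈ Y v, 0 ≤ t → σ.IsAt v t := by
  classical
  obtain ⟨τ₀, hτ₀, hmax, hedge⟩ : ∃ τ₀, 0 < τ₀ ∧ τ₀ ≤ τmax ∧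
      ∀ u v, M.graph.Adj u v → τ₀ ≤ M.length s(u, v) := by
    -- The value `1` at non-edges is a dummy, so that `ε` is a common lower bound of the edge
    -- lengths.
    obtain ⟨ε, hε, hlt⟩ := Pi.exists_forall_pos_add_lt (x := fun _ : V × V => (0 : ℝ))
      (y := fun q => if M.graph.Adj q.1 q.2 then M.length s(q.1, q.2) else 1)
      (by intro q; split_ifs with hq; exacts [M.edge_pos hq, one_pos])
    refine ⟨min ε τmax, lt_min hε hτ, min_le_right _ _, fun u v huv => ?_⟩
    have := hlt (u, v)
    simp only [huv, if_true, zero_add] at this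
    exact (min_le_left _ _).trans this.le
  choose! f g hmove hin hvis hlong hlong' using
    fun (v : V) (t : ℝ) (h : M.InTime Y v t) =>
      h.exists_move hc hτ₀ hmax hedge hclosed hlip
  let q : ℕ → V × ℝ := fun n => (fun p : V × ℝ => (f p.1 p.2, p.2 + g p.1 p.2))^[n] (v₀, 0)
  have hq : ∀ n, q (n + 1) = (f (q n).1 (q n).2, (q n).2 + g (q n).1 (q n).2) := fun n =>
    Function.iterate_succ_apply' _ _ _
  have hI : ∀ n, M.InTime Y (q n).1 (q n).2 := fun n => by
    induction n with
    | zero => exact h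
    | succ n ih => rw [hq]; exact hin _ _ ih
  have hstep : ∀ n, M.IsMove τmax (q n).1 (q (n + 1)).1 ((q (n + 1)).2 - (q n).2) := fun n => by
    rw [hq]; simpa using hmove _ _ (hI n)
  -- Single waits may be arbitrarily short, but two consecutive steps together last at least `τ₀`.
  have htwo : ∀ n, (q n).2 + τ₀ ≤ (q (n + 2)).2 := fun n => by
    have h1 := (hstep n).pos
    have h2 := (hstep (n + 1)).pos
    have e1 : (q (n + 1)).2 = _ := congrArg Prod.snd (hq n)
    have e2 : (q (n + 2)).2 = _ := congrArg Prod.snd (hq (n + 1))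
    rcases hlong _ _ (hI n) with h3 | h3
    · simp only at e1; linarith
    · have h4 := hlong' _ _ (hI (n + 1)) (by rw [hq]; exact h3)
      simp only at e2; linarith
  have hmono : StrictMono fun n => (q n).2 := strictMono_nat_of_lt_succ fun n => by
    linarith [(hstep n).pos]
  have hlim : Tendsto (fun n => (q n).2) atTop atTop := by
    refine tendsto_atTop_atTop_of_monotone hmono.monotone fun b => ?_
    have hmul : ∀ m : ℕ, m * τ₀ ≤ (q (2 * m)).2 := fun m => by
      induction m with
      | zero => simp [q]
      | succ m ih =>
        have := htwo (2 * m)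
        rw [show 2 * (m + 1) = 2 * m + 2 by ring]
        push_cast
        linarith
    obtain ⟨m, hm⟩ := Archimedean.arch b hτ₀
    exact ⟨2 * m, hm.trans (by simpa using hmul m)⟩
  refine ⟨⟨fun n => (q n).1, fun n => (q n).2, rfl, hstep, hlim⟩, rfl, fun v t ht h0 => ?_⟩
  obtain ⟨j, hj, hj'⟩ := exists_le_lt_succ hlim (t := t) h0
  refine ⟨j, hj, hj', ?_⟩
  have := hvis _ _ (hI j) v t ht hj (by simpa [hq] using hj')
  simpa [hq] using this

end Schedule

/-! ## Latencies -/

section Latency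

variable {V : Type*} {M : Env V} {k : ℕ}

theorem Env.lastVisit_le_of_forall (π : M.Strategy k) {v : V} {t b : ℝ≥0}
    (h : ∀ r, ∀ t' ≤ t, π t' r = M.node v → t' ≤ b) : M.lastVisit π v t ≤ b :=
  ciSup_le' fun r => csSup_le' fun t' ht' => h r t' ht'.1 ht'.2

theorem Env.lastVisit_le (π : M.Strategy k) (v : V) (t : ℝ≥0) : M.lastVisit π v t ≤ t :=
  M.lastVisit_le_of_forall π fun _ _ h _ => h

theorem Env.le_lastVisit (π : M.Strategy k) {v : V} {t t' : ℝ≥0} {r : Fin k} (h : t' ≤ t)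
    (hv : π t' r = M.node v) : t' ≤ M.lastVisit π v t :=
  (le_csSup ⟨t, fun _ h => h.1⟩ ⟨h, hv⟩ :
    t' ≤ sSup {t' : ℝ≥0 | t' ≤ t ∧ π t' r = M.node v}).trans
    (le_ciSup (f := fun r => sSup {t' : ℝ≥0 | t' ≤ t ∧ π t' r = M.node v})
      (Set.finite_range _).bddAbove r)

/-- The strict bound rules out the value `0` of an empty supremum, so there is a genuine visit. -/
theorem Env.exists_visit_of_lt_lastVisit (π : M.Strategy k) {v : V} {t b : ℝ≥0}
    (h : b < M.lastVisit π v t) : ∃ r, ∃ t', b < t' ∧ t' ≤ t ∧ π t' r = M.node v := by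
  obtain ⟨r, hr⟩ := exists_lt_of_lt_ciSup' h
  obtain ⟨t', ht', hlt⟩ := exists_lt_of_lt_csSup' hr
  exact ⟨r, t', hlt, ht'⟩

theorem Env.latency_eq_zero (π : M.Strategy k) {v : V} {t : ℝ≥0} {r : Fin k}
    (hv : π t r = M.node v) : M.latency π v t = 0 := by
  rw [Env.latency, le_antisymm (M.lastVisit_le π v t) (M.le_lastVisit π le_rfl hv), sub_self]

theorem Env.weight_mul_latency_le [Finite V] (π : M.Strategy k) (v : V) (t : ℝ≥0) :
    M.weight v * M.latency π v t ≤ M.worstLatency π t :=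
  le_ciSup (f := fun v => M.weight v * M.latency π v t) (Set.finite_range _).bddAbove v

theorem Env.minWeight_le [Finite V] (v : V) : M.minWeight ≤ M.weight v :=
  ciInf_le (Set.finite_range _).bddBelow v

theorem Env.minWeight_pos [Finite V] [Nonempty V] : 0 < M.minWeight := by
  obtain ⟨v, hv⟩ := exists_eq_ciInf_of_finite (f := M.weight)
  rw [Env.minWeight, ← hv]
  exact M.weight_pos v

end Latency

/-! ## Limits of minimizing sequences -/

section Limit

variable {V : Type*} {M : Env V} {k : ℕ}

/-- The visits of a limit of strategies, along an ultrafilter, to the nodes. -/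
def Env.limitVisits (M : Env V) (𝒰 : Ultrafilter ℕ) (π : ℕ → M.Strategy k) (r : Fin k) (v : V) :
    Set ℝ :=
  {t | ∀ ε > 0, ∀ᶠ n in 𝒰, ∃ t' : ℝ≥0, |(t' : ℝ) - t| < ε ∧ π n t' r = M.node v}

theorem Env.isClosed_limitVisits (𝒰 : Ultrafilter ℕ) (π : ℕ → M.Strategy k) (r : Fin k) (v : V) :
    IsClosed (M.limitVisits 𝒰 π r v) := by
  refine isClosed_of_closure_subset fun t ht ε hε => ?_
  obtain ⟨t₁, ht₁, hd⟩ := Metric.mem_closure_iff.1 ht (ε / 2) (half_pos hε)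
  filter_upwards [ht₁ (ε / 2) (half_pos hε)] with n ⟨t', h1, h2⟩
  refine ⟨t', ?_, h2⟩
  rw [Real.dist_eq, abs_sub_comm] at hd
  calc |(t' : ℝ) - t| = |((t' : ℝ) - t₁) + (t₁ - t)| := by ring_nf
    _ ≤ |(t' : ℝ) - t₁| + |t₁ - t| := abs_add_le _ _
    _ < ε := by linarith

/-- A single index `n` serves both windows, so the speed bound of `π n` applies up to `ε`. -/
theorem Env.nodeDist_le_of_mem_limitVisits {𝒰 : Ultrafilter ℕ} {π : ℕ → M.Strategy k}
    (hπ : ∀ n, π n ∈ M.feasible k) {r : Fin k} {u u' : V} {t t' : ℝ}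
    (h : t ∈ M.limitVisits 𝒰 π r u) (h' : t' ∈ M.limitVisits 𝒰 π r u') :
    M.nodeDist u u' ≤ |t - t'| := by
  refine le_of_forall_pos_le_add fun ε hε => ?_
  obtain ⟨n, ⟨a, ha, hau⟩, ⟨b, hb, hbu⟩⟩ :=
    ((h _ (half_pos hε)).and (h' _ (half_pos hε))).exists
  have h1 := hπ n a b r
  rw [hau, hbu] at h1
  have h2 : |(a : ℝ) - b| ≤ |(a : ℝ) - t| + |t - t'| + |(b : ℝ) - t'| := by
    calc |(a : ℝ) - b| = |((a : ℝ) - t) + (t - t') + -((b : ℝ) - t')| := by ring_nf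
      _ ≤ |((a : ℝ) - t) + (t - t')| + |-((b : ℝ) - t')| := abs_add_le _ _
      _ ≤ _ := by rw [abs_neg]; gcongr; exact abs_add_le _ _
  unfold Env.nodeDist
  linarith

/-- There are finitely many robots, so the ultrafilter selects one that makes the visit for almost
all `n`; its visit times lie in a compact interval and converge along the ultrafilter. The
hypothesis `hT` keeps the left end of the window positive, which excludes the default value of
`lastVisit`. -/
theorem Env.exists_mem_limitVisits [Finite V] {𝒰 : Ultrafilter ℕ} {π : ℕ → M.Strategy k} {T : ℝ}
    {c : ℕ → ℝ} {c₀ : ℝ} (hc : Tendsto c 𝒰 (𝓝 c₀))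
    (hπ : ∀ n (t : ℝ≥0), T ≤ t → M.worstLatency (π n) t < c n) {v : V}
    (hT : c₀ / M.weight v < T) {t : ℝ} (ht0 : 0 ≤ t) (ht : T ≤ t) :
    ∃ r, ∃ t' ∈ M.limitVisits 𝒰 π r v, t - c₀ / M.weight v ≤ t' ∧ t' ≤ t := by
  have hw := M.weight_pos v
  lift t to ℝ≥0 using ht0
  have hlim : Tendsto (fun n => (t : ℝ) - c n / M.weight v) 𝒰 (𝓝 (t - c₀ / M.weight v)) :=
    tendsto_const_nhds.sub (hc.div_const _)
  have hex : ∀ᶠ n in 𝒰, ∃ r, ∃ t' : ℝ≥0, (t : ℝ) - c n / M.weight v ≤ t' ∧ t' ≤ t ∧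
      π n t' r = M.node v := by
    filter_upwards [hlim.eventually_const_lt (show 0 < (t : ℝ) - c₀ / M.weight v by linarith)]
      with n hn
    have h1 := (M.weight_mul_latency_le (π n) v t).trans_lt (hπ n t ht)
    rw [mul_comm, ← lt_div_iff₀ hw, Env.latency] at h1
    obtain ⟨b, hb⟩ : ∃ b : ℝ≥0, (b : ℝ) = t - c n / M.weight v :=
      ⟨_, Real.coe_toNNReal _ hn.le⟩
    have h2 : b < M.lastVisit (π n) v t := by
      rw [← NNReal.coe_lt_coe]; linarith
    obtain ⟨r, t', ht', h⟩ := M.exists_visit_of_lt_lastVisit _ h2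
    exact ⟨r, t', hb ▸ (NNReal.coe_lt_coe.2 ht').le, h⟩
  obtain ⟨r, hr⟩ := Ultrafilter.eventually_exists_iff.1 hex
  let a : ℕ → ℝ≥0 := fun n => Classical.epsilon fun t' : ℝ≥0 =>
    (t : ℝ) - c n / M.weight v ≤ t' ∧ t' ≤ t ∧ π n t' r = M.node v
  have ha : ∀ᶠ n in 𝒰, (t : ℝ) - c n / M.weight v ≤ a n ∧ a n ≤ t ∧ π n (a n) r = M.node v :=
    hr.mono fun n hn => Classical.epsilon_spec hn
  obtain ⟨t', -, ht'⟩ := (isCompact_Icc (a := (0 : ℝ)) (b := t)).ultrafilter_le_nhds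
    (𝒰.map fun n => (a n : ℝ)) (by
      rw [le_principal_iff]
      exact ha.mono fun n hn => ⟨(a n).2, hn.2.1⟩)
  have hta : Tendsto (fun n => (a n : ℝ)) 𝒰 (𝓝 t') := ht'
  refine ⟨r, t', fun ε hε => ?_, le_of_tendsto_of_tendsto hlim hta (ha.mono fun n hn => hn.1),
    le_of_tendsto hta (ha.mono fun n hn => hn.2.1)⟩
  filter_upwards [ha, hta.eventually (Metric.ball_mem_nhds t' hε)] with n hn hn'
  exact ⟨a n, hn', hn.2.2⟩

/-- There are schedules for the robots, from arbitrary initial nodes, that realize the optimal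
worst latency from shortly before the time `T` on. -/
theorem Env.exists_optimal_schedules [Finite V] (hc : M.graph.Connected) (p₀ : Fin k → V)
    {τmax : ℝ} (hτ : 0 < τmax) {T : ℝ} (hfin : M.optimalTailLatency k T ≠ ∞)
    (hT : M.diameter + (M.optimalTailLatency k T).toReal / M.minWeight < T) :
    ∃ σ : Fin k → M.Schedule τmax, (∀ r, (σ r).node 0 = p₀ r) ∧ ∃ T' < T, ∀ t : ℝ≥0, T' ≤ t →
      ∀ v, ∃ r, ∃ t' : ℝ≥0,
        t - (M.optimalTailLatency k T).toReal / M.weight v ≤ t' ∧ t' ≤ t ∧ (σ r).IsAt v t' := by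
  have := hc.nonempty
  set J := M.optimalTailLatency k T
  have hJ0 : 0 ≤ J.toReal := ENNReal.toReal_nonneg
  have hD : 0 ≤ M.diameter := Real.iSup_nonneg fun q => M.pathDist_nonneg _ _
  have hφ := M.minWeight_pos
  have hJφ : ∀ v, J.toReal / M.weight v ≤ J.toReal / M.minWeight := fun v =>
    div_le_div_of_nonneg_left hJ0 hφ (M.minWeight_le v)
  have hJφ0 : 0 ≤ J.toReal / M.minWeight := by positivity
  have hseq : ∀ n : ℕ, ∃ π ∈ M.feasible k, ∀ t : ℝ≥0, T ≤ t →
      M.worstLatency π t < J.toReal + 1 / ((n : ℝ) + 1) := by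
    intro n
    have hn : (0 : ℝ) < 1 / ((n : ℝ) + 1) := by positivity
    have hlt : J < J + ENNReal.ofReal (1 / ((n : ℝ) + 1)) :=
      ENNReal.lt_add_right hfin (ENNReal.ofReal_pos.2 hn).ne'
    obtain ⟨π, hπ⟩ := iInf_lt_iff.1 hlt
    obtain ⟨hf, hπ⟩ := iInf_lt_iff.1 hπ
    refine ⟨π, hf, fun t ht => ?_⟩
    have h1 : ENNReal.ofReal (M.worstLatency π t) < J + ENNReal.ofReal (1 / ((n : ℝ) + 1)) :=
      (le_iSup₂ (f := fun (t : ℝ≥0) (_ : T ≤ t) => ENNReal.ofReal (M.worstLatency π t))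
        t ht).trans_lt hπ
    rw [← ENNReal.ofReal_toReal hfin, ← ENNReal.ofReal_add hJ0 hn.le] at h1
    exact (ENNReal.ofReal_lt_ofReal_iff (by positivity)).1 h1
  choose π hf hπ using hseq
  have hlim : Tendsto (fun n : ℕ => J.toReal + 1 / ((n : ℝ) + 1)) (hyperfilter ℕ)
      (𝓝 J.toReal) := by
    simpa using ((tendsto_one_div_add_atTop_nhds_zero_nat (𝕜 := ℝ)).const_add J.toReal).mono_left
      Nat.hyperfilter_le_atTop
  -- The slack in `hT`. Visits are moved earlier by `s`, and those then before the diameter are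
  -- dropped, so every remaining one is reachable from any initial node. Nothing needed is lost: a
  -- window ending at `t ≥ T - s` begins no earlier than the diameter.
  set s := T - (M.diameter + J.toReal / M.minWeight) with hs
  let Y : Fin k → V → Set ℝ := fun r v =>
    (fun t => t + s) ⁻¹' M.limitVisits (hyperfilter ℕ) π r v ∩ Set.Ici M.diameter
  have hex : ∀ r, ∃ σ : M.Schedule τmax, σ.node 0 = p₀ r ∧
      ∀ v, ∀ t ∈ Y r v, 0 ≤ t → σ.IsAt v t := fun r => by
    refine M.exists_schedule hc hτ (fun v => ?_) (fun u u' t ht t' ht' => ?_)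
      (fun u t' ht' _ => ?_)
    · exact ((M.isClosed_limitVisits _ _ _ _).preimage (by fun_prop)).inter isClosed_Ici
    · simpa using M.nodeDist_le_of_mem_limitVisits hf ht.1 ht'.1
    · rw [sub_zero]
      exact (M.pathDist_le_diameter hc _ _).trans ht'.2
  choose σ hσ0 hσ using hex
  refine ⟨σ, hσ0, T - s, by linarith, fun t ht v => ?_⟩
  obtain ⟨r, t', ht', h1, h2⟩ := M.exists_mem_limitVisits hlim hπ (v := v) (t := t + s)
    (by linarith [hJφ v]) (by linarith [t.2]) (by linarith)
  have h3 := hJφ v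
  have h4 : M.diameter ≤ t' - s := by linarith
  have h5 : 0 ≤ t' - s := by linarith
  obtain ⟨x, hx⟩ : ∃ x : ℝ≥0, (x : ℝ) = t' - s := ⟨_, Real.coe_toNNReal _ h5⟩
  refine ⟨r, x, by linarith, ?_, hσ r v _ ⟨?_, hx ▸ h4⟩ x.2⟩
  · rw [← NNReal.coe_le_coe]; linarith
  · simpa [hx] using ht'

end Limit

/-! ## Trajectories of the decision process -/

section Trajectory

variable {V : Type*} {M : Env V} {k : ℕ} {τmax T : ℝ}

/-- The robot is on its way on an edge, or it waits. -/
def Env.ValidPos (M : Env V) (p : RobotState V) : Prop :=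
  0 ≤ p.2.2 ∧ ((M.graph.Adj p.1 p.2.1 ∧ p.2.2 ≤ M.length s(p.1, p.2.1)) ∨ p.1 = p.2.1)

theorem Env.point_wait {x : V} {ρ : ℝ} : M.point (x, x, ρ) = M.node x := by
  simp [Env.point]

theorem Env.point_edge {x y : V} {ρ : ℝ} (h : M.graph.Adj x y) (h0 : 0 ≤ ρ)
    (h1 : ρ ≤ M.length s(x, y)) :
    M.point (x, y, ρ) = M.edgePoint h ⟨1 - ρ / M.length s(x, y), edgeFraction_mem ⟨h0, h1⟩⟩ := by
  unfold Env.point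
  rw [dif_pos ⟨h, h0, h1⟩]

theorem Env.point_full {x y : V} (h : M.graph.Adj x y) :
    M.point (x, y, M.length s(x, y)) = M.node x := by
  have := M.edge_pos h
  rw [M.point_edge h this.le le_rfl]
  exact M.edgePoint_eq_left h (by simp [this.ne'])

theorem Env.ValidPos.point_zero {x y : V} (h : M.ValidPos (x, y, 0)) :
    M.point (x, y, 0) = M.node y := by
  obtain ⟨-, ⟨h, -⟩ | h⟩ := h
  · rw [M.point_edge h le_rfl (M.edge_pos h).le]
    exact M.edgePoint_eq_right h (by simp)
  · obtain rfl : x = y := h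
    exact Env.point_wait

/-- The strict `ρ < δ` excludes the start of a segment; interior points of edges are not nodes, so
the robot is waiting or just arriving. -/
theorem Env.ValidPos.eq_of_point_eq_node {x y v : V} {δ ρ : ℝ} (h : M.ValidPos (x, y, δ))
    (h0 : 0 ≤ ρ) (h1 : ρ < δ) (hv : M.point (x, y, ρ) = M.node v) :
    y = v ∧ (x = v ∨ ρ = 0) := by
  obtain ⟨-, ⟨h, hδ⟩ | h⟩ := h
  · simp only at h hδ
    have hlen := M.edge_pos h
    rcases h0.eq_or_lt with rfl | h0
    · rw [Env.ValidPos.point_zero ⟨le_rfl, Or.inl ⟨h, hlen.le⟩⟩] at hv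
      exact ⟨M.node_injective hv, Or.inr rfl⟩
    · rw [M.point_edge h h0.le (h1.le.trans hδ)] at hv
      refine (M.edgePoint_ne_node h ?_ ?_ v hv).elim
      · change 0 < 1 - ρ / M.length s(x, y)
        rw [sub_pos, div_lt_one hlen]
        linarith
      · change 1 - ρ / M.length s(x, y) < 1
        have : 0 < ρ / M.length s(x, y) := by positivity
        linarith
  · obtain rfl : x = y := h
    rw [Env.point_wait] at hv
    have := M.node_injective hv
    exact ⟨this, Or.inl this⟩

theorem Env.ValidPos.pathDist_point_le {x y : V} {δ ρ ρ' : ℝ} (h : M.ValidPos (x, y, δ))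
    (h0 : 0 ≤ ρ) (h1 : ρ ≤ δ) (h0' : 0 ≤ ρ') (h1' : ρ' ≤ δ) :
    M.pathDist (M.point (x, y, ρ)) (M.point (x, y, ρ')) ≤ |ρ - ρ'| := by
  obtain ⟨-, ⟨h, hδ⟩ | h⟩ := h
  · simp only at h hδ
    have hlen := M.edge_pos h
    rw [M.point_edge h h0 (h1.trans hδ), M.point_edge h h0' (h1'.trans hδ)]
    refine (M.pathDist_edgePoint_le h _ _).trans (le_of_eq ?_)
    simp only
    rw [sub_sub_sub_cancel_left, ← sub_div, abs_div, abs_of_pos hlen, abs_sub_comm,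
      div_mul_cancel₀ _ hlen.ne']
  · obtain rfl : x = y := h
    rw [Env.point_wait, Env.point_wait, M.pathDist_self]
    exact abs_nonneg _

theorem Env.ValidPos.assign {p : RobotState V} {a : RobotAction V} (h : M.ValidPos p)
    (ha : a ∈ M.robotActions τmax p) :
    M.ValidPos (assign p a) ∧ 0 < (Monitoring.assign p a).2.2 := by
  rcases ha with ⟨-, v, τ, rfl, ⟨hv, rfl⟩ | ⟨rfl, h0, -⟩⟩ | ⟨h0, rfl⟩
  · exact ⟨⟨(M.edge_pos hv).le, Or.inl ⟨hv, le_rfl⟩⟩, M.edge_pos hv⟩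
  · exact ⟨⟨h0.le, Or.inr rfl⟩, h0⟩
  · exact ⟨h, h.1.lt_of_ne' h0⟩

theorem duration_le (s : State V k) (a : Action V k) (r : Fin k) :
    duration T s a ≤ (assign (s.pos r) (a r)).2.2 := by
  have h : ⨅ r, (assign (s.pos r) (a r)).2.2 ≤ (assign (s.pos r) (a r)).2.2 :=
    ciInf_le (Set.finite_range _).bddBelow r
  unfold duration
  simp only
  split_ifs
  exacts [(min_le_left _ _).trans h, h]

theorem duration_pos (hk : 0 < k) {s : State V k} {a : Action V k}
    (h : ∀ r, 0 < (assign (s.pos r) (a r)).2.2) : 0 < duration T s a := by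
  have : Nonempty (Fin k) := ⟨⟨0, hk⟩⟩
  have hpos : 0 < ⨅ r, (assign (s.pos r) (a r)).2.2 := by
    obtain ⟨r, hr⟩ := exists_eq_ciInf_of_finite (f := fun r => (assign (s.pos r) (a r)).2.2)
    rw [← hr]
    exact h r
  unfold duration
  simp only
  split_ifs with hT
  exacts [lt_min hpos (sub_pos.2 hT), hpos]

/-- The sequences of states and available actions which the deterministic transition allows. -/
structure Env.IsTrajectory (M : Env V) (τmax T : ℝ) (p₀ : Fin k → V)
    (ξ : ℕ → State V k × Action V k) : Prop where
  init : (ξ 0).1 = initState p₀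
  available : ∀ n, (ξ n).2 ∈ M.actions τmax (ξ n).1
  step : ∀ n, (ξ (n + 1)).1 = M.step T (ξ n).1 (ξ n).2

theorem eventTime_zero (ξ : ℕ → State V k × Action V k) : eventTime T ξ 0 = 0 := by
  simp [eventTime]

theorem eventTime_succ (ξ : ℕ → State V k × Action V k) (n : ℕ) :
    eventTime T ξ (n + 1) = eventTime T ξ n + duration T (ξ n).1 (ξ n).2 :=
  Finset.sum_range_succ _ _

/-- The segment which the robot `r` carries out after the event number `n`. -/
def segment (ξ : ℕ → State V k × Action V k) (n : ℕ) (r : Fin k) : RobotState V :=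
  assign ((ξ n).1.pos r) ((ξ n).2 r)

/-- The position at the time `t` in the segment after the event number `n`. -/
noncomputable def Env.segmentPoint (M : Env V) (T : ℝ) (ξ : ℕ → State V k × Action V k) (n : ℕ)
    (r : Fin k) (t : ℝ) : M.Realization :=
  M.point ((segment ξ n r).1, (segment ξ n r).2.1,
    (segment ξ n r).2.2 - (t - eventTime T ξ n))

namespace Env.IsTrajectory

variable {p₀ : Fin k → V} {ξ : ℕ → State V k × Action V k} (h : M.IsTrajectory τmax T p₀ ξ)
include h

theorem pos_succ (n : ℕ) (r : Fin k) : (ξ (n + 1)).1.pos r = nextPos T (ξ n).1 (ξ n).2 r := by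
  rw [h.step]; rfl

theorem validPos (n : ℕ) (r : Fin k) : M.ValidPos ((ξ n).1.pos r) := by
  induction n generalizing r with
  | zero => rw [h.init]; exact ⟨le_rfl, Or.inr rfl⟩
  | succ n ih =>
    rw [h.pos_succ]
    obtain ⟨⟨-, hv⟩, -⟩ := (ih r).assign (h.available n r)
    have hd := duration_le (T := T) (ξ n).1 (ξ n).2 r
    have hd0 : 0 ≤ duration T (ξ n).1 (ξ n).2 :=
      (duration_pos r.pos fun r' => ((ih r').assign (h.available n r')).2).le
    exact ⟨sub_nonneg.2 hd, hv.imp_left fun hv => ⟨hv.1, (sub_le_self _ hd0).trans hv.2⟩⟩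

theorem validPos_segment (n : ℕ) (r : Fin k) : M.ValidPos (segment ξ n r) :=
  ((h.validPos n r).assign (h.available n r)).1

theorem duration_pos (hk : 0 < k) (n : ℕ) : 0 < duration T (ξ n).1 (ξ n).2 :=
  Monitoring.duration_pos hk fun r => ((h.validPos n r).assign (h.available n r)).2

theorem strictMono (hk : 0 < k) : StrictMono (eventTime T ξ) :=
  strictMono_nat_of_lt_succ fun n => by
    rw [eventTime_succ]; linarith [h.duration_pos hk n]

theorem eventTime_nonneg (hk : 0 < k) (n : ℕ) : 0 ≤ eventTime T ξ n := by
  rw [← eventTime_zero (T := T) ξ]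
  exact (h.strictMono hk).monotone (Nat.zero_le n)

theorem elapsed_eq (hk : 0 < k) (hT : 0 < T) (n : ℕ) :
    (ξ n).1.elapsed = min (eventTime T ξ n) T := by
  induction n with
  | zero => rw [h.init, eventTime_zero, min_eq_left hT.le]; rfl
  | succ n ih =>
    have hd := h.duration_pos hk n
    have : (ξ (n + 1)).1.elapsed = min ((ξ n).1.elapsed + duration T (ξ n).1 (ξ n).2) T := by
      rw [h.step]; rfl
    rw [this, ih, eventTime_succ]
    rcases le_total (eventTime T ξ n) T with hle | hle
    · rw [min_eq_left hle]
    · rw [min_eq_right hle, min_eq_right (by linarith), min_eq_right (by linarith)]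

theorem segment_succ (n : ℕ) (r : Fin k) :
    ((segment ξ n r).2.2 = duration T (ξ n).1 (ξ n).2 ∧
      (segment ξ (n + 1) r).1 = (segment ξ n r).2.1 ∧
      M.IsMove τmax (segment ξ (n + 1) r).1 (segment ξ (n + 1) r).2.1
        (segment ξ (n + 1) r).2.2) ∨
    (segment ξ n r).2.2 ≠ duration T (ξ n).1 (ξ n).2 ∧
      segment ξ (n + 1) r = ((segment ξ n r).1, (segment ξ n r).2.1,
        (segment ξ n r).2.2 - duration T (ξ n).1 (ξ n).2) := by
  have ha := h.available (n + 1) r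
  rw [h.pos_succ] at ha
  rw [show segment ξ (n + 1) r = assign (nextPos T (ξ n).1 (ξ n).2 r) ((ξ (n + 1)).2 r) by
    rw [← h.pos_succ]; rfl]
  rcases ha with ⟨h0, v, τ, ha, hm⟩ | ⟨h0, ha⟩
  · rw [ha]
    exact Or.inl ⟨sub_eq_zero.1 h0, rfl, hm⟩
  · rw [ha]
    exact Or.inr ⟨fun h => h0 (sub_eq_zero.2 h), rfl⟩

/-- Continuity at events: a completed segment ends at its target, where the next one begins. -/
theorem segmentPoint_succ (n : ℕ) (r : Fin k) :
    M.segmentPoint T ξ n r (eventTime T ξ (n + 1)) =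
      M.segmentPoint T ξ (n + 1) r (eventTime T ξ (n + 1)) := by
  unfold Env.segmentPoint
  rw [sub_self, sub_zero, eventTime_succ, add_sub_cancel_left]
  rcases h.segment_succ n r with ⟨h1, h2, h3⟩ | ⟨-, h1⟩
  · have hz : M.ValidPos ((segment ξ n r).1, (segment ξ n r).2.1, 0) :=
      ⟨le_rfl, (h.validPos_segment n r).2.imp_left fun h => ⟨h.1, (M.edge_pos h.1).le⟩⟩
    rw [h1, sub_self, hz.point_zero, ← h2]
    rcases h3 with ⟨h3, h4⟩ | ⟨h3, -⟩
    · rw [h4, M.point_full h3]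
    · rw [h3, Env.point_wait]
  · rw [h1]

/-- At the right end the strategy has already switched to the next segment. Since both agree there,
the formula holds on the closed interval, and each step can be treated on its own. -/
theorem strategy_eq (hk : 0 < k) {n : ℕ} {t : ℝ≥0} (r : Fin k) (h1 : eventTime T ξ n ≤ t)
    (h2 : t ≤ eventTime T ξ (n + 1)) :
    M.trajectoryStrategy T ξ t r = M.segmentPoint T ξ n r t := by
  have key : ∀ m, eventTime T ξ m ≤ t → t < eventTime T ξ (m + 1) →
      M.trajectoryStrategy T ξ t r = M.segmentPoint T ξ m r t := by
    intro m h1 h2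
    have hs : {n : ℕ | eventTime T ξ n ≤ t} = Set.Iic m := by
      ext i
      simp only [Set.mem_ofPred_eq, Set.mem_Iic]
      constructor
      · intro hi
        exact Nat.lt_succ_iff.1 ((h.strictMono hk).lt_iff_lt.1 (hi.trans_lt h2))
      · intro hi
        exact ((h.strictMono hk).monotone hi).trans h1
    unfold Env.trajectoryStrategy
    rw [hs, csSup_Iic]
    rfl
  rcases h2.lt_or_eq with h2 | h2
  · exact key n h1 h2
  · rw [key (n + 1) h2.ge (h2 ▸ h.strictMono hk (Nat.lt_succ_self _)), h2,
      h.segmentPoint_succ]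

theorem pathDist_segmentPoint_le (n : ℕ) (r : Fin k) {t t' : ℝ}
    (h1 : eventTime T ξ n ≤ t) (h2 : t ≤ eventTime T ξ (n + 1))
    (h1' : eventTime T ξ n ≤ t') (h2' : t' ≤ eventTime T ξ (n + 1)) :
    M.pathDist (M.segmentPoint T ξ n r t) (M.segmentPoint T ξ n r t') ≤ |t - t'| := by
  have hd : _ ≤ (segment ξ n r).2.2 := duration_le (T := T) (ξ n).1 (ξ n).2 r
  rw [eventTime_succ] at h2 h2'
  refine (Env.ValidPos.pathDist_point_le (δ := (segment ξ n r).2.2) (h.validPos_segment n r) (by linarith) (by linarith)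
    (by linarith) (by linarith)).trans (le_of_eq ?_)
  rw [abs_sub_comm t]
  congr 1
  ring

/-- The strategy described by a trajectory is feasible. -/
theorem feasible [Finite V] (hc : M.graph.Connected) (hk : 0 < k)
    (hlim : Tendsto (eventTime T ξ) atTop atTop) :
    M.trajectoryStrategy T ξ ∈ M.feasible k := by
  have key : ∀ (r : Fin k) (n : ℕ) (t t' : ℝ≥0), t ≤ t' → t' ≤ eventTime T ξ n →
      M.pathDist (M.trajectoryStrategy T ξ t r) (M.trajectoryStrategy T ξ t' r) ≤
        |(t : ℝ) - t'| := by
    intro r n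
    induction n with
    | zero =>
      intro t t' hle h0
      rw [eventTime_zero] at h0
      have h1 : t' = 0 := le_antisymm (by exact_mod_cast h0) (zero_le)
      obtain rfl : t = t' := le_antisymm hle (h1 ▸ zero_le)
      rw [M.pathDist_self]
      exact abs_nonneg _
    | succ n ih =>
      intro t t' hle h2'
      rcases le_total (t' : ℝ) (eventTime T ξ n) with hn | hn
      · exact ih t t' hle hn
      have hle' : (t : ℝ) ≤ t' := hle
      rcases le_total (eventTime T ξ n) (t : ℝ) with hn' | hn'
      · rw [h.strategy_eq hk r hn' (hle'.trans h2'), h.strategy_eq hk r hn h2']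
        exact h.pathDist_segmentPoint_le n r hn' (hle'.trans h2') hn h2'
      · obtain ⟨x, hx⟩ : ∃ x : ℝ≥0, (x : ℝ) = eventTime T ξ n :=
          ⟨_, Real.coe_toNNReal _ (h.eventTime_nonneg hk n)⟩
        have hsucc := (h.strictMono hk (Nat.lt_succ_self n)).le
        have e1 := ih t x (NNReal.coe_le_coe.1 (hx ▸ hn')) hx.le
        have e2 := h.pathDist_segmentPoint_le n r le_rfl hsucc hn h2'
        rw [← hx, ← h.strategy_eq hk r hx.ge (hx ▸ hsucc), ← h.strategy_eq hk r hn h2'] at e2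
        refine (M.pathDist_triangle hc _ _ _).trans ((add_le_add e1 e2).trans (le_of_eq ?_))
        rw [abs_of_nonpos (by linarith), abs_of_nonpos (by linarith),
          abs_of_nonpos (by linarith)]
        ring
  intro t t' r
  obtain ⟨n, hn⟩ := (hlim.eventually_ge_atTop (max (t : ℝ) t')).exists
  rcases le_total t t' with hle | hle
  · exact key r n t t' hle ((le_max_right _ _).trans hn)
  · rw [M.pathDist_comm, abs_sub_comm]
    exact key r n t' t hle ((le_max_left _ _).trans hn)

theorem strategy_zero (hk : 0 < k) (r : Fin k) :
    M.trajectoryStrategy T ξ 0 r = M.node (p₀ r) := by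
  have h1 := (h.strictMono hk (Nat.lt_succ_self 0)).le
  rw [eventTime_zero] at h1
  rw [h.strategy_eq hk r (n := 0) (by simp [eventTime_zero]) (by simpa using h1)]
  have ha := h.available 0 r
  unfold Env.segmentPoint segment
  rw [eventTime_zero, NNReal.coe_zero, sub_self, sub_zero]
  rw [h.init] at ha ⊢
  rcases ha with ⟨-, v, τ, ha, ⟨hv, rfl⟩ | ⟨rfl, -⟩⟩ | ⟨h0, -⟩
  · rw [ha]; exact M.point_full hv
  · rw [ha]; exact M.point_wait
  · exact (h0 rfl).elim

/-! ### Visits and latencies -/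

theorem strategy_eq_node_of_occupied (hk : 0 < k) {n : ℕ} {v : V}
    (hv : occupied (ξ n).1 (ξ n).2 v) :
    ∃ r, ∀ t : ℝ≥0, eventTime T ξ n ≤ t → t ≤ eventTime T ξ (n + 1) →
      M.trajectoryStrategy T ξ t r = M.node v := by
  obtain ⟨r, h1, h2⟩ := hv
  refine ⟨r, fun t ht ht' => ?_⟩
  rw [h.strategy_eq hk r ht ht', Env.segmentPoint,
    show (segment ξ n r).1 = v from h1, show (segment ξ n r).2.1 = v from h2, Env.point_wait]

/-- The left end is excluded because a robot that is leaving `v` is still there at that moment; this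
visit is already accounted for in the state. -/
theorem occupied_of_strategy_eq (hk : 0 < k) {n : ℕ} {r : Fin k} {v : V} {t : ℝ≥0}
    (h1 : eventTime T ξ n < t) (h2 : t ≤ eventTime T ξ (n + 1))
    (hv : M.trajectoryStrategy T ξ t r = M.node v) :
    occupied (ξ n).1 (ξ n).2 v ∨
      ((segment ξ n r).2.1 = v ∧ (segment ξ n r).2.2 = t - eventTime T ξ n) := by
  have hd : _ ≤ (segment ξ n r).2.2 := duration_le (T := T) (ξ n).1 (ξ n).2 r
  rw [h.strategy_eq hk r h1.le h2, Env.segmentPoint] at hv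
  rw [eventTime_succ] at h2
  obtain ⟨e1, e2 | e2⟩ :=
    Env.ValidPos.eq_of_point_eq_node (δ := (segment ξ n r).2.2) (h.validPos_segment n r)
      (by linarith) (by linarith) hv
  · exact Or.inl ⟨r, e2, e1⟩
  · exact Or.inr ⟨e1, by linarith⟩

theorem visited_of_strategy_eq (hk : 0 < k) {n : ℕ} {r : Fin k} {v : V} {t : ℝ≥0}
    (h1 : eventTime T ξ n < t) (h2 : t = eventTime T ξ (n + 1))
    (hv : M.trajectoryStrategy T ξ t r = M.node v) : visited T (ξ n).1 (ξ n).2 v := by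
  refine (h.occupied_of_strategy_eq hk h1 h2.le hv).imp_right fun ⟨e1, e2⟩ => ⟨r, e1, ?_⟩
  rw [h2, eventTime_succ] at e2
  change (segment ξ n r).2.2 - _ = 0
  linarith

theorem occupied_of_strategy_eq_of_lt (hk : 0 < k) {n : ℕ} {r : Fin k} {v : V} {t : ℝ≥0}
    (h1 : eventTime T ξ n < t) (h2 : t < eventTime T ξ (n + 1))
    (hv : M.trajectoryStrategy T ξ t r = M.node v) : occupied (ξ n).1 (ξ n).2 v := by
  refine (h.occupied_of_strategy_eq hk h1 h2.le hv).resolve_right fun ⟨_, e2⟩ => ?_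
  have hd : _ ≤ (segment ξ n r).2.2 := duration_le (T := T) (ξ n).1 (ξ n).2 r
  rw [eventTime_succ] at h2
  linarith

theorem exists_strategy_eq_of_visited (hk : 0 < k) {n : ℕ} {v : V} {t : ℝ≥0}
    (ht : t = eventTime T ξ (n + 1)) (hv : visited T (ξ n).1 (ξ n).2 v) :
    ∃ r, M.trajectoryStrategy T ξ t r = M.node v := by
  have hsucc := (h.strictMono hk (Nat.lt_succ_self n)).le
  rcases hv with hv | ⟨r, e1, e2⟩
  · obtain ⟨r, hr⟩ := h.strategy_eq_node_of_occupied hk hv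
    exact ⟨r, hr t (ht ▸ hsucc) ht.le⟩
  · refine ⟨r, ?_⟩
    have e1 : (segment ξ n r).2.1 = v := e1
    have e2 : (segment ξ n r).2.2 - duration T (ξ n).1 (ξ n).2 = 0 := e2
    rw [h.strategy_eq hk r (ht ▸ hsucc) ht.le, Env.segmentPoint, ht, eventTime_succ,
      add_sub_cancel_left, e2, Env.ValidPos.point_zero, e1]
    exact ⟨le_rfl, (h.validPos_segment n r).2.imp_left fun h => ⟨h.1, (M.edge_pos h.1).le⟩⟩

end Env.IsTrajectory

theorem Env.latency_eq_add (π : M.Strategy k) {v : V} {t₀ t : ℝ≥0} (hle : t₀ ≤ t)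
    (hno : ∀ r, ∀ t', t₀ < t' → t' ≤ t → π t' r ≠ M.node v) :
    M.latency π v t = M.latency π v t₀ + (t - t₀) := by
  have : M.lastVisit π v t = M.lastVisit π v t₀ := by
    refine le_antisymm (M.lastVisit_le_of_forall π fun r t' ht' hv => ?_)
      (M.lastVisit_le_of_forall π fun r t' ht' hv => M.le_lastVisit π (ht'.trans hle) hv)
    rcases le_or_gt t' t₀ with h | h
    · exact M.le_lastVisit π h hv
    · exact (hno r t' h ht' hv).elim
  rw [Env.latency, Env.latency, this]
  ring

namespace Env.IsTrajectory

variable {p₀ : Fin k → V} {ξ : ℕ → State V k × Action V k} (h : M.IsTrajectory τmax T p₀ ξ)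
include h

/-- Strictly inside a step only a waiting robot can be at a node; every other visit happens at an
event. So the recursion for the latencies misses nothing. -/
theorem latency_eventTime (hk : 0 < k) (n : ℕ) (v : V) {t : ℝ≥0} (ht : t = eventTime T ξ n) :
    M.latency (M.trajectoryStrategy T ξ) v t = (ξ n).1.lat v := by
  induction n generalizing t with
  | zero =>
    rw [eventTime_zero] at ht
    obtain rfl : t = 0 := by exact_mod_cast ht
    rw [h.init, Env.latency, le_antisymm (M.lastVisit_le _ v 0) (zero_le), sub_self]
    rfl
  | succ n ih =>
    obtain ⟨t₀, ht₀⟩ : ∃ x : ℝ≥0, (x : ℝ) = eventTime T ξ n :=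
      ⟨_, Real.coe_toNNReal _ (h.eventTime_nonneg hk n)⟩
    have hlt := h.strictMono hk (Nat.lt_succ_self n)
    have hlat : (ξ (n + 1)).1.lat v = nextLat T (ξ n).1 (ξ n).2 v := by rw [h.step]; rfl
    rw [hlat, nextLat]
    split_ifs with hv
    · obtain ⟨r, hr⟩ := h.exists_strategy_eq_of_visited hk ht hv
      exact M.latency_eq_zero _ hr
    · rw [M.latency_eq_add (t₀ := t₀), ih ht₀, ht, ht₀, eventTime_succ, add_sub_cancel_left]
      · rw [← NNReal.coe_le_coe, ht, ht₀]; exact hlt.le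
      · intro r t' h1 h2 hv'
        rw [← NNReal.coe_lt_coe, ht₀] at h1
        rw [← NNReal.coe_le_coe, ht] at h2
        rcases h2.lt_or_eq with h2 | h2
        · exact hv (Or.inl (h.occupied_of_strategy_eq_of_lt hk h1 h2 hv'))
        · exact hv (h.visited_of_strategy_eq hk h1 h2 hv')

theorem latency_of_not_occupied (hk : 0 < k) {n : ℕ} {v : V}
    (hv : ¬occupied (ξ n).1 (ξ n).2 v) {t : ℝ≥0} (h1 : eventTime T ξ n ≤ t)
    (h2 : t < eventTime T ξ (n + 1)) :
    M.latency (M.trajectoryStrategy T ξ) v t = (ξ n).1.lat v + (t - eventTime T ξ n) := by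
  obtain ⟨t₀, ht₀⟩ : ∃ x : ℝ≥0, (x : ℝ) = eventTime T ξ n :=
    ⟨_, Real.coe_toNNReal _ (h.eventTime_nonneg hk n)⟩
  rw [M.latency_eq_add (t₀ := t₀), h.latency_eventTime hk n v ht₀, ht₀]
  · rw [← NNReal.coe_le_coe, ht₀]; exact h1
  · intro r t' e1 e2 hv'
    rw [← NNReal.coe_lt_coe, ht₀] at e1
    exact hv (h.occupied_of_strategy_eq_of_lt hk e1 (lt_of_le_of_lt (by exact_mod_cast e2) h2)
      hv')

/-- The counter is the event time cut off at `T`, so it equals `T` exactly from the first event not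
before `T` on. -/
theorem tracker_succ (hk : 0 < k) (hT : 0 < T) (n : ℕ) :
    (ξ (n + 1)).1.tracker = if T ≤ eventTime T ξ (n + 1) then
      max (ξ n).1.tracker (⨆ v, M.weight v * peakLat T (ξ n).1 (ξ n).2 v) else 0 := by
  have h1 : (ξ (n + 1)).1.elapsed = nextElapsed T (ξ n).1 (ξ n).2 := by rw [h.step]; rfl
  have h2 : (ξ (n + 1)).1.tracker = M.nextTracker T (ξ n).1 (ξ n).2 := by rw [h.step]; rfl
  rw [h2, Env.nextTracker, ← h1, h.elapsed_eq hk hT]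
  simp only [min_eq_right_iff]

theorem tracker_eq_zero (hk : 0 < k) (hT : 0 < T) {n : ℕ} (hn : eventTime T ξ n < T) :
    (ξ n).1.tracker = 0 := by
  cases n with
  | zero => rw [h.init]; rfl
  | succ n => rw [h.tracker_succ hk hT, if_neg hn.not_ge]

theorem monotone_tracker (hk : 0 < k) (hT : 0 < T) : Monotone fun n => (ξ n).1.tracker := by
  refine monotone_nat_of_le_succ fun n => ?_
  rw [h.tracker_succ hk hT]
  split_ifs with hn
  · exact le_max_left _ _
  · exact (h.tracker_eq_zero hk hT
      ((h.strictMono hk (Nat.lt_succ_self n)).trans (not_le.1 hn))).le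

theorem weight_mul_peakLat_le [Finite V] (hk : 0 < k) (hT : 0 < T) {n : ℕ}
    (hn : T ≤ eventTime T ξ (n + 1)) (v : V) :
    M.weight v * peakLat T (ξ n).1 (ξ n).2 v ≤ (ξ (n + 1)).1.tracker := by
  rw [h.tracker_succ hk hT, if_pos hn]
  exact (le_ciSup (f := fun v => M.weight v * peakLat T (ξ n).1 (ξ n).2 v)
    (Set.finite_range _).bddAbove v).trans (le_max_right _ _)

/-- The tracker dominates the worst latency after the time `T`. -/
theorem tailLatency_le [Finite V] (hc : M.graph.Connected) (hk : 0 < k) (hT : 0 < T)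
    (hlim : Tendsto (eventTime T ξ) atTop atTop) :
    M.tailLatency T (M.trajectoryStrategy T ξ) ≤ ⨆ n, ENNReal.ofReal (ξ n).1.tracker := by
  have := hc.nonempty
  refine iSup₂_le fun t ht => ?_
  obtain ⟨n, h1, h2⟩ := exists_le_lt_succ hlim (t := t) (by simp [eventTime_zero])
  refine le_iSup_of_le (n + 1) (ENNReal.ofReal_le_ofReal (ciSup_le fun v => ?_))
  by_cases hv : occupied (ξ n).1 (ξ n).2 v
  · obtain ⟨r, hr⟩ := h.strategy_eq_node_of_occupied hk hv
    rw [M.latency_eq_zero _ (hr t h1 h2.le), mul_zero]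
    have := h.monotone_tracker hk hT (Nat.zero_le (n + 1))
    simpa [h.init, initState, State.tracker] using this
  · refine le_trans ?_ (h.weight_mul_peakLat_le hk hT (ht.trans h2.le) v)
    rw [h.latency_of_not_occupied hk hv h1 h2, peakLat, if_neg hv]
    rw [eventTime_succ] at h2
    have := M.weight_pos v
    gcongr
    linarith

/-- The tracker is bounded by every bound of the weighted latencies that holds from some time
before `T` on. -/
theorem tracker_le [Finite V] (hk : 0 < k) (hT : 0 < T) {T' c : ℝ} (hT' : T' < T) (hc0 : 0 ≤ c)
    (hc : ∀ t : ℝ≥0, T' ≤ t → ∀ v,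
      M.weight v * M.latency (M.trajectoryStrategy T ξ) v t ≤ c) (n : ℕ) :
    (ξ n).1.tracker ≤ c := by
  induction n with
  | zero => rw [h.init]; exact hc0
  | succ n ih =>
    rw [h.tracker_succ hk hT]
    split_ifs with hn
    swap
    · exact hc0
    refine max_le ih (Real.iSup_le (fun v => ?_) hc0)
    unfold peakLat
    split_ifs with hv
    · rwa [mul_zero]
    have hw := M.weight_pos v
    by_contra! hlt
    rw [← div_lt_iff₀' hw] at hlt
    -- Half the excess of the left limit over the bound. A time in this step that is after `T'` and
    -- within `g` of the end already violates `hc`; it exists even if the step ends at `T`, because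
    -- `T' < T`.
    set g := ((ξ n).1.lat v + duration T (ξ n).1 (ξ n).2 - c / M.weight v) / 2 with hg
    have hg0 : 0 < g := by rw [hg]; linarith
    have hsucc := h.strictMono hk (Nat.lt_succ_self n)
    have hmax1 := le_max_right T' (eventTime T ξ n)
    obtain ⟨t, ht⟩ : ∃ t : ℝ≥0,
        (t : ℝ) = max (max T' (eventTime T ξ n)) (eventTime T ξ (n + 1) - g) :=
      ⟨_, Real.coe_toNNReal _ (((h.eventTime_nonneg hk n).trans (le_max_right _ _)).trans
        (le_max_left _ _))⟩
    have h1 : eventTime T ξ n ≤ t := ht ▸ (le_max_right _ _).trans (le_max_left _ _)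
    have h2 : t < eventTime T ξ (n + 1) := by
      rw [ht]; exact max_lt (max_lt (hT'.trans_le hn) hsucc) (by linarith)
    have h3 : eventTime T ξ (n + 1) - g ≤ t := ht ▸ le_max_right _ _
    have h4 := hc t (ht ▸ (le_max_left _ _).trans (le_max_left _ _)) v
    rw [h.latency_of_not_occupied hk hv h1 h2, ← le_div_iff₀' hw] at h4
    rw [eventTime_succ] at h3
    linarith

end Env.IsTrajectory

end Trajectory

/-! ## The trajectory of given schedules -/

section Joint

variable {V : Type*} {M : Env V} {k : ℕ} {τmax T : ℝ}

/-- The number of moves completed up to the time `t`. -/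
noncomputable def Env.Schedule.index (σ : M.Schedule τmax) (t : ℝ) : ℕ :=
  Classical.epsilon fun j => σ.time j ≤ t ∧ t < σ.time (j + 1)

theorem Env.Schedule.index_eq (σ : M.Schedule τmax) {t : ℝ} {j : ℕ}
    (h1 : σ.time j ≤ t) (h2 : t < σ.time (j + 1)) : σ.index t = j := by
  have h := Classical.epsilon_spec (p := fun j => σ.time j ≤ t ∧ t < σ.time (j + 1)) ⟨j, h1, h2⟩
  exact eq_of_le_of_lt_succ σ.strictMono h.1 h.2 h1 h2

open Classical in
/-- The joint action that the schedules prescribe at the time `t`. -/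
noncomputable def scheduleAction (σ : Fin k → M.Schedule τmax) (s : State V k) (t : ℝ) :
    Action V k := fun r =>
  if (s.pos r).2.2 = 0 then
    Sum.inr ((σ r).node ((σ r).index t + 1), (σ r).time ((σ r).index t + 1) - t)
  else Sum.inl ()

/-- The robot position `p` at the time `t`, before new actions are assigned, is the one which the
schedule describes. -/
def Env.Schedule.Matches (σ : M.Schedule τmax) (p : RobotState V) (t : ℝ) : Prop :=
  ∃ j, (σ.time j = t ∧ p.2.1 = σ.node j ∧ p.2.2 = 0) ∨
    (σ.time j < t ∧ t < σ.time (j + 1) ∧ p = (σ.node j, σ.node (j + 1), σ.time (j + 1) - t))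

/-- A free robot is at a completion time of its schedule, so what is prescribed is a whole move or
wait of the schedule, not a remainder of one, and is therefore available. -/
theorem Env.Schedule.Matches.assign {σ : Fin k → M.Schedule τmax} {s : State V k} {t : ℝ}
    {r : Fin k} (h : (σ r).Matches (s.pos r) t) :
    scheduleAction σ s t r ∈ M.robotActions τmax (s.pos r) ∧
    ∃ j, (σ r).time j ≤ t ∧ t < (σ r).time (j + 1) ∧
      assign (s.pos r) (scheduleAction σ s t r) =
        ((σ r).node j, (σ r).node (j + 1), (σ r).time (j + 1) - t) := by
  obtain ⟨j, ⟨rfl, h2, h3⟩ | ⟨h1, h2, h3⟩⟩ := h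
  · have hlt := (σ r).strictMono (Nat.lt_succ_self j)
    have hi := (σ r).index_eq le_rfl hlt
    have ha : scheduleAction σ s ((σ r).time j) r =
        Sum.inr ((σ r).node (j + 1), (σ r).time (j + 1) - (σ r).time j) := by
      rw [scheduleAction, if_pos h3, hi]
    rw [ha]
    refine ⟨Or.inl ⟨h3, _, _, rfl, ?_⟩, j, le_rfl, hlt, ?_⟩
    · rw [h2]; exact (σ r).isMove j
    · simp [Monitoring.assign, h2]
  · have h4 : (s.pos r).2.2 ≠ 0 := by rw [h3]; exact (sub_pos.2 h2).ne'
    have ha : scheduleAction σ s t r = Sum.inl () := by rw [scheduleAction, if_neg h4]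
    rw [ha]
    exact ⟨Or.inr ⟨h4, rfl⟩, j, h1.le, h2, h3⟩

theorem Env.Schedule.Matches.nextPos {σ : Fin k → M.Schedule τmax} {s : State V k} {t : ℝ}
    (h : ∀ r, (σ r).Matches (s.pos r) t) (r : Fin k) :
    (σ r).Matches (nextPos T s (scheduleAction σ s t) r)
      (t + duration T s (scheduleAction σ s t)) := by
  obtain ⟨-, j, h1, h2, h3⟩ := (h r).assign
  have hd := duration_le (T := T) s (scheduleAction σ s t) r
  have hd0 : 0 < duration T s (scheduleAction σ s t) := duration_pos r.pos fun r' => by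
    obtain ⟨-, j, -, h2, h3⟩ := (h r').assign
    rw [h3]
    exact sub_pos.2 h2
  unfold Monitoring.nextPos
  rw [h3] at hd ⊢
  rcases hd.eq_or_lt with hd | hd
  · exact ⟨j + 1, Or.inl ⟨by simp only at hd; linarith, rfl, by simp [hd]⟩⟩
  · refine ⟨j, Or.inr ⟨by linarith, by simp only at hd; linarith, ?_⟩⟩
    simp only [Prod.mk.injEq, true_and]
    ring

/-- The states and the times of the events, if the robots follow their schedules. -/
noncomputable def scheduleState (T : ℝ) (σ : Fin k → M.Schedule τmax) : ℕ → State V k × ℝ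
  | 0 => (initState fun r => (σ r).node 0, 0)
  | n + 1 =>
    let q := scheduleState T σ n
    (M.step T q.1 (scheduleAction σ q.1 q.2), q.2 + duration T q.1 (scheduleAction σ q.1 q.2))

theorem matches_scheduleState (σ : Fin k → M.Schedule τmax) (n : ℕ) (r : Fin k) :
    (σ r).Matches ((scheduleState T σ n).1.pos r) (scheduleState T σ n).2 := by
  induction n generalizing r with
  | zero => exact ⟨0, Or.inl ⟨(σ r).time_zero, rfl, rfl⟩⟩
  | succ n ih => exact Env.Schedule.Matches.nextPos ih r

theorem tendsto_atTop_of_finite {f : ℕ → ℝ} (hf : StrictMono f)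
    (h : ∀ b, (Set.range f ∩ Set.Iic b).Finite) : Tendsto f atTop atTop := by
  refine tendsto_atTop_atTop_of_monotone hf.monotone fun b => ?_
  by_contra! hb
  refine Set.infinite_range_of_injective hf.injective ((h b).subset ?_)
  rintro _ ⟨n, rfl⟩
  exact ⟨⟨n, rfl⟩, (hb n).le⟩

theorem Env.exists_isTrajectory (hk : 0 < k) (hT : 0 < T) (σ : Fin k → M.Schedule τmax) :
    ∃ ξ, M.IsTrajectory τmax T (fun r => (σ r).node 0) ξ ∧
      Tendsto (eventTime T ξ) atTop atTop ∧
      ∀ (v : V) (r : Fin k) (t : ℝ≥0), (σ r).IsAt v t →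
        M.trajectoryStrategy T ξ t r = M.node v := by
  have : Nonempty (Fin k) := ⟨⟨0, hk⟩⟩
  let q := scheduleState T σ
  let ξ : ℕ → State V k × Action V k := fun n => ((q n).1, scheduleAction σ (q n).1 (q n).2)
  have hξ : M.IsTrajectory τmax T (fun r => (σ r).node 0) ξ :=
    ⟨rfl, fun n r => (matches_scheduleState σ n r).assign.1, fun n => rfl⟩
  have htime : ∀ n, eventTime T ξ n = (q n).2 := fun n => by
    induction n with
    | zero => exact eventTime_zero ξ
    | succ n ih => rw [eventTime_succ, ih]; rfl
  have hseg : ∀ n r, ∃ j, (σ r).time j ≤ eventTime T ξ n ∧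
      segment ξ n r = ((σ r).node j, (σ r).node (j + 1),
        (σ r).time (j + 1) - eventTime T ξ n) := fun n r => by
    obtain ⟨-, j, h1, -, h3⟩ := (matches_scheduleState (T := T) σ n r).assign
    rw [htime]
    exact ⟨j, h1, h3⟩
  -- Every event is the horizon or a completion time of some schedule (time `0` included). These
  -- times are locally finite, so events cannot accumulate.
  have hE : ∀ n, eventTime T ξ n ∈ insert T (⋃ r, Set.range (σ r).time) := fun n => by
    cases n with
    | zero =>
      rw [eventTime_zero]
      exact Or.inr (Set.mem_iUnion.2 ⟨⟨0, hk⟩, 0, (σ _).time_zero⟩)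
    | succ n =>
      obtain ⟨r, hr⟩ := exists_eq_ciInf_of_finite (f := fun r => (segment ξ n r).2.2)
      obtain ⟨j, -, hj⟩ := hseg n r
      have hmem : eventTime T ξ n + ⨅ r, (segment ξ n r).2.2 ∈
          insert T (⋃ r, Set.range (σ r).time) :=
        Or.inr (Set.mem_iUnion.2 ⟨r, j + 1, by rw [← hr, hj]; ring⟩)
      have hdur : duration T (ξ n).1 (ξ n).2 = if (ξ n).1.elapsed < T then
          min (⨅ r, (segment ξ n r).2.2) (T - (ξ n).1.elapsed)
          else ⨅ r, (segment ξ n r).2.2 := rfl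
      rw [eventTime_succ, hdur]
      split_ifs with hel
      · rcases min_choice (⨅ r, (segment ξ n r).2.2) (T - (ξ n).1.elapsed) with h | h
        · rw [h]; exact hmem
        · rw [h]
          rw [hξ.elapsed_eq hk hT] at hel ⊢
          rw [min_eq_left ((min_lt_iff.1 hel).resolve_right (lt_irrefl T)).le]
          exact Or.inl (by ring)
      · exact hmem
  have hlim : Tendsto (eventTime T ξ) atTop atTop := by
    refine tendsto_atTop_of_finite (hξ.strictMono hk) fun b => ?_
    have hfin : (insert T (⋃ r, Set.range (σ r).time ∩ Set.Iic b)).Finite := by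
      refine (Set.finite_iUnion fun r => ?_).insert T
      obtain ⟨N, hN⟩ := ((σ r).tendsto.eventually_gt_atTop b).exists_forall_of_atTop
      refine ((Set.finite_Iio N).image (σ r).time).subset ?_
      rintro _ ⟨⟨j, rfl⟩, hj⟩
      refine ⟨j, ?_, rfl⟩
      by_contra hle
      exact (hN j (not_lt.1 hle)).not_ge hj
    refine hfin.subset ?_
    rintro _ ⟨⟨n, rfl⟩, hb⟩
    refine (hE n).imp_right fun h => ?_
    obtain ⟨r, hr⟩ := Set.mem_iUnion.1 h
    exact Set.mem_iUnion.2 ⟨r, hr, hb⟩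
  refine ⟨ξ, hξ, hlim, ?_⟩
  rintro v r t ⟨j, hj1, hj2, rfl, hj3⟩
  obtain ⟨n, h1, h2⟩ := exists_le_lt_succ hlim (t := t) (by simp [eventTime_zero])
  obtain ⟨i, hi, hs⟩ := hseg n r
  have hd : _ ≤ (segment ξ n r).2.2 := duration_le (T := T) (ξ n).1 (ξ n).2 r
  -- No step outlasts a remaining duration, so the move of the segment containing `t` is the one in
  -- the schedule, `i = j`.
  have hlt : t < (σ r).time (i + 1) := by
    rw [eventTime_succ] at h2
    rw [hs] at hd
    simp only at hd
    linarith
  obtain rfl := eq_of_le_of_lt_succ (σ r).strictMono (hi.trans h1) hlt hj1 hj2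
  rw [hξ.strategy_eq hk r h1 h2.le, Env.segmentPoint, hs]
  simp only
  rcases hj3 with hj3 | hj3
  · rcases (σ r).isMove i with ⟨ha, hl⟩ | ⟨hw, -⟩
    · rw [← M.point_full ha, ← hl]
      congr 3
      linarith
    · rw [hw, M.point_wait]
  · rw [hj3, M.point_wait]

end Joint

/-! ## The law of the trajectories -/

/-- If `a < b < u m`, all terms from `m` on exceed `b`, and they alone push the mean above `a` once
`N > m * b / (b - a)`. The terms may be infinite. -/
theorem tendsto_cesaro_of_monotone {u : ℕ → ℝ≥0∞} (hu : Monotone u) :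
    Tendsto (fun N : ℕ => (N : ℝ≥0∞)⁻¹ * ∑ n ∈ Finset.range N, u n) atTop (𝓝 (⨆ n, u n)) := by
  refine tendsto_order.2 ⟨fun a ha => ?_, fun a ha => Eventually.of_forall fun N => ?_⟩
  · obtain ⟨m, hm⟩ := lt_iSup_iff.1 ha
    obtain ⟨b, hab, hb⟩ := ENNReal.lt_iff_exists_nnreal_btwn.1 hm
    lift a to ℝ≥0 using (hab.trans_le le_top).ne
    have hab' : (a : ℝ) < b := by exact_mod_cast hab
    obtain ⟨N₀, hN₀⟩ := exists_nat_gt ((m : ℝ) * b / (b - a))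
    filter_upwards [eventually_ge_atTop (max N₀ (m + 1))] with N hN
    have hN1 : m + 1 ≤ N := (le_max_right _ _).trans hN
    have hN2 : (N₀ : ℝ) ≤ N := by exact_mod_cast (le_max_left _ _).trans hN
    have hNpos : (N : ℝ≥0∞) ≠ 0 := by
      have : N ≠ 0 := by omega
      exact_mod_cast this
    rw [mul_comm, ← div_eq_mul_inv,
      ENNReal.lt_div_iff_mul_lt (Or.inl hNpos) (Or.inl (ENNReal.natCast_ne_top N))]
    have h1 : a * (N : ℝ≥0) < ((N - m : ℕ) : ℝ≥0) * b := by
      rw [← NNReal.coe_lt_coe]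
      simp only [NNReal.coe_mul, NNReal.coe_natCast]
      rw [Nat.cast_sub (by omega)]
      rw [div_lt_iff₀ (sub_pos.2 hab')] at hN₀
      nlinarith
    calc (a : ℝ≥0∞) * N < ((N - m : ℕ) : ℝ≥0∞) * b := by exact_mod_cast h1
      _ ≤ ∑ n ∈ Finset.Ico m N, u n := by
        rw [← nsmul_eq_mul, ← Nat.card_Ico]
        exact Finset.card_nsmul_le_sum _ _ _ fun n hn =>
          hb.le.trans (hu (Finset.mem_Ico.1 hn).1)
      _ ≤ ∑ n ∈ Finset.range N, u n := by
        refine Finset.sum_le_sum_of_subset fun n hn => ?_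
        exact Finset.mem_range.2 (Finset.mem_Ico.1 hn).2
  · refine lt_of_le_of_lt ?_ ha
    calc (N : ℝ≥0∞)⁻¹ * ∑ n ∈ Finset.range N, u n
        ≤ (N : ℝ≥0∞)⁻¹ * (N * ⨆ n, u n) := by
          gcongr
          simpa using Finset.sum_le_card_nsmul (Finset.range N) u (⨆ n, u n)
            fun n _ => le_iSup u n
      _ ≤ ⨆ n, u n := by
          rw [← mul_assoc]
          exact mul_le_of_le_one_left zero_le (ENNReal.inv_mul_le_one _)

instance measurableSingletonClass_sum {α β : Type*} [MeasurableSpace α] [MeasurableSpace β]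
    [MeasurableSingletonClass α] [MeasurableSingletonClass β] :
    MeasurableSingletonClass (α ⊕ β) where
  measurableSet_singleton x := by
    rcases x with x | x
    · rw [← Set.image_singleton]; exact (measurableSet_singleton x).inl_image
    · rw [← Set.image_singleton]; exact (measurableSet_singleton x).inr_image

instance State.measurableSingletonClass {V : Type*} [MeasurableSpace V]
    [MeasurableSingletonClass V] [Countable V] {k : ℕ} : MeasurableSingletonClass (State V k) :=
  inferInstanceAs
    (MeasurableSingletonClass ((Fin k → RobotState V) × (V → ℝ) × ℝ × ℝ))

instance Action.measurableSingletonClass {V : Type*} [MeasurableSpace V]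
    [MeasurableSingletonClass V] {k : ℕ} : MeasurableSingletonClass (Action V k) :=
  Pi.instMeasurableSingletonClass

instance measurableSingletonClass_state_action {V : Type*} [MeasurableSpace V]
    [MeasurableSingletonClass V] [Countable V] {k : ℕ} :
    MeasurableSingletonClass (State V k × Action V k) :=
  Prod.instMeasurableSingletonClass

theorem map_eval_zero_trajMeasure {X : Type*} [MeasurableSpace X] (μ₀ : Measure X)
    (κ : (n : ℕ) → Kernel (Π _ : Finset.Iic n, X) X) [∀ n, IsMarkovKernel (κ n)] :
    (Kernel.trajMeasure (X := fun _ => X) μ₀ κ).map (fun x => x 0) = μ₀ := by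
  have h1 : (fun x : ℕ → X => x 0) =
      (fun y : (Π _ : Finset.Iic 0, X) => y ⟨0, by simp⟩) ∘ Preorder.frestrictLe 0 := rfl
  rw [h1, ← Measure.map_map (by fun_prop) (by fun_prop), Kernel.trajMeasure,
    Measure.map_comp _ _ (by fun_prop), Kernel.traj_map_frestrictLe, Kernel.partialTraj_self,
    Measure.id_comp, Measure.map_map (by fun_prop) (by fun_prop)]
  exact Measure.map_id

section Law

variable {V : Type*} [MeasurableSpace V] [Finite V] [DiscreteMeasurableSpace V] {M : Env V}
  {k : ℕ} {τmax T : ℝ}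

/-- Target and duration of a new action can be read off from `assign`, which is measurable; this
removes the quantifier over real durations. -/
theorem Env.measurableSet_actions (M : Env V) (τmax : ℝ) :
    MeasurableSet {x : State V k × Action V k | x.2 ∈ M.actions τmax x.1} := by
  have hset : {x : State V k × Action V k | x.2 ∈ M.actions τmax x.1} = ⋂ r,
      {x | ((x.1.pos r).2.2 = 0 ∧ x.2 r ∈ Set.range Sum.inr ∧
        ((M.graph.Adj (x.1.pos r).2.1 (assign (x.1.pos r) (x.2 r)).2.1 ∧
            (assign (x.1.pos r) (x.2 r)).2.2 =
              M.length s((x.1.pos r).2.1, (assign (x.1.pos r) (x.2 r)).2.1)) ∨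
          ((assign (x.1.pos r) (x.2 r)).2.1 = (x.1.pos r).2.1 ∧
            0 < (assign (x.1.pos r) (x.2 r)).2.2 ∧
            (assign (x.1.pos r) (x.2 r)).2.2 ≤ τmax))) ∨
        ((x.1.pos r).2.2 ≠ 0 ∧ x.2 r = Sum.inl ())} := by
    ext x
    simp only [Env.actions, Env.robotActions, Set.mem_ofPred_eq, Set.mem_iInter]
    refine forall_congr' fun r => or_congr (and_congr_right fun _ => ?_) Iff.rfl
    constructor
    · rintro ⟨v, τ, h, h'⟩
      rw [h]
      exact ⟨⟨_, rfl⟩, h'⟩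
    · rintro ⟨⟨⟨v, τ⟩, h⟩, h'⟩
      rw [← h] at h'
      exact ⟨v, τ, h.symm, h'⟩
  rw [hset]
  refine MeasurableSet.iInter fun r => ?_
  have hp : Measurable fun x : State V k × Action V k => x.1.pos r := by
    unfold State.pos; fun_prop
  have ha := measurable_assign_coord (V := V) (k := k) r
  have hx : Measurable fun x : State V k × Action V k => x.2 r := by fun_prop
  have hq : Measurable fun x : State V k × Action V k =>
      ((x.1.pos r).2.1, (assign (x.1.pos r) (x.2 r)).2.1) := hp.snd.fst.prodMk ha.snd.fst
  have h0 : MeasurableSet {x : State V k × Action V k | (x.1.pos r).2.2 = 0} :=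
    hp.snd.snd (measurableSet_singleton 0)
  refine (h0.inter ((hx measurableSet_range_inr).inter (.union ?_ ?_))).union
    (h0.compl.inter (hx (measurableSet_singleton _)))
  · exact (hq (t := {q | M.graph.Adj q.1 q.2}) .of_discrete).inter (measurableSet_eq_fun
      ha.snd.snd ((Measurable.of_discrete (f := fun q : V × V => M.length s(q.1, q.2))).comp hq))
  · exact (measurableSet_eq_fun ha.snd.fst hp.snd.fst).inter
      ((measurableSet_lt measurable_const ha.snd.snd).inter
        (measurableSet_le ha.snd.snd measurable_const))

omit [Finite V] [DiscreteMeasurableSpace V] in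
theorem Env.Policy.ae_id_prod_kernel (μ : M.Policy k τmax) {s : State V k}
    {P : State V k × Action V k → Prop} (hP : MeasurableSet {x | P x})
    (h : ∀ᵐ a ∂(μ.kernel s), P (s, a)) : ∀ᵐ x ∂((Kernel.id ×ₖ μ.kernel) s), P x := by
  have := μ.isMarkov
  rw [Kernel.prod_apply, Kernel.id_apply, Measure.dirac_prod, ae_map_iff (by fun_prop) hP]
  exact h

theorem Env.Policy.ae_law_zero (μ : M.Policy k τmax) (T : ℝ) {s : State V k}
    {P : State V k × Action V k → Prop} (hP : MeasurableSet {x | P x})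
    (h : ∀ᵐ a ∂(μ.kernel s), P (s, a)) : ∀ᵐ ξ ∂(μ.law T s), P (ξ 0) := by
  have h1 := μ.ae_id_prod_kernel hP h
  rw [← map_eval_zero_trajMeasure ((Kernel.id ×ₖ μ.kernel) s) (μ.historyKernel T)] at h1
  exact ae_of_ae_map (measurable_pi_apply 0).aemeasurable h1

/-- The joint law of the history and the next pair is a composition product with `historyKernel`,
which looks only at the last pair; almost sure one-step properties thus pass to the law. -/
theorem Env.Policy.ae_law_succ (μ : M.Policy k τmax) (T : ℝ) (s : State V k)
    {P : (State V k × Action V k) × (State V k × Action V k) → Prop}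
    (hP : MeasurableSet {x | P x})
    (h : ∀ x, ∀ᵐ a ∂(μ.kernel (M.step T x.1 x.2)), P (x, (M.step T x.1 x.2, a))) (n : ℕ) :
    ∀ᵐ ξ ∂(μ.law T s), P (ξ n, ξ (n + 1)) := by
  have := μ.isMarkov
  have h1 := Kernel.map_frestrictLe_trajMeasure_compProd_eq_map_trajMeasure
    (X := fun _ => State V k × Action V k) (μ₀ := (Kernel.id ×ₖ μ.kernel) s)
    (κ := μ.historyKernel T) (a := n)
  let f : (Π _ : Finset.Iic n, State V k × Action V k) × (State V k × Action V k) →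
      (State V k × Action V k) × (State V k × Action V k) :=
    fun q => (q.1 ⟨n, Finset.mem_Iic.2 le_rfl⟩, q.2)
  have hf : Measurable f := by fun_prop
  have h2 : ∀ᵐ q ∂(((μ.law T s).map (Preorder.frestrictLe n)) ⊗ₘ μ.historyKernel T n),
      P (f q) := by
    refine Measure.ae_compProd_of_ae_ae (hf hP) (Eventually.of_forall fun y => ?_)
    exact μ.ae_id_prod_kernel (P := fun z => P (y ⟨n, Finset.mem_Iic.2 le_rfl⟩, z))
      (measurable_prodMk_left hP) (h _)
  rw [Env.Policy.law, h1] at h2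
  exact ae_of_ae_map (f := fun x : ℕ → State V k × Action V k =>
    (Preorder.frestrictLe n x, x (n + 1))) (by fun_prop) h2

theorem Env.Policy.ae_isTrajectory (μ : M.Policy k τmax) (T : ℝ) (p₀ : Fin k → V) :
    ∀ᵐ ξ ∂(μ.law T (initState p₀)), M.IsTrajectory τmax T p₀ ξ := by
  have h0 := μ.ae_law_zero T (s := initState p₀)
    (P := fun x => x.1 = initState p₀ ∧ x.2 ∈ M.actions τmax x.1)
    ((measurableSet_eq_fun measurable_fst measurable_const).inter (M.measurableSet_actions τmax))
    ((μ.available _).mono fun a ha => ⟨rfl, ha⟩)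
  have h1 := fun n => μ.ae_law_succ T (initState p₀)
    (P := fun x => x.2.1 = M.step T x.1.1 x.1.2 ∧ x.2.2 ∈ M.actions τmax x.2.1)
    ((measurableSet_eq_fun measurable_snd.fst ((M.measurable_step T).comp measurable_fst)).inter
      (measurable_snd (M.measurableSet_actions τmax)))
    (fun x => (μ.available _).mono fun a ha => ⟨rfl, ha⟩) n
  filter_upwards [h0, ae_all_iff.2 h1] with ξ h0 h1
  refine ⟨h0.1, fun n => ?_, fun n => (h1 n).1⟩
  cases n with
  | zero => exact h0.2
  | succ n => exact (h1 n).2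

omit [Finite V] [DiscreteMeasurableSpace V] in
theorem measurable_tracker (n : ℕ) :
    Measurable fun ξ : ℕ → State V k × Action V k => ENNReal.ofReal (ξ n).1.tracker := by
  unfold State.tracker
  fun_prop

theorem Env.Policy.tendsto_meanReward (μ : M.Policy k τmax) (hk : 0 < k) (hT : 0 < T)
    (p₀ : Fin k → V) :
    Tendsto (μ.meanReward T (initState p₀)) atTop
      (𝓝 (∫⁻ ξ, ⨆ n, ENNReal.ofReal (ξ n).1.tracker ∂(μ.law T (initState p₀)))) := by
  have hmono : ∀ᵐ ξ ∂(μ.law T (initState p₀)), Monotone fun n => (ξ n).1.tracker :=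
    (μ.ae_isTrajectory T p₀).mono fun ξ h => h.monotone_tracker hk hT
  rw [lintegral_iSup_ae measurable_tracker
    fun n => hmono.mono fun ξ h => ENNReal.ofReal_le_ofReal (h n.le_succ)]
  exact tendsto_cesaro_of_monotone fun m n hmn =>
    lintegral_mono_ae (hmono.mono fun ξ h => ENNReal.ofReal_le_ofReal (h hmn))

theorem Env.Policy.averageReward_eq (μ : M.Policy k τmax) (hk : 0 < k) (hT : 0 < T)
    (p₀ : Fin k → V) :
    μ.averageReward T (initState p₀) =
      ∫⁻ ξ, ⨆ n, ENNReal.ofReal (ξ n).1.tracker ∂(μ.law T (initState p₀)) :=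
  (μ.tendsto_meanReward hk hT p₀).limsup_eq

/-! ### Deterministic policies -/

/-- The policy which picks the action `f s` in the state `s`. -/
noncomputable def Env.Policy.deterministic (M : Env V) (f : State V k → Action V k)
    (hf : Measurable f) (hav : ∀ s, f s ∈ M.actions τmax s) : M.Policy k τmax where
  kernel := Kernel.deterministic f hf
  isMarkov := inferInstance
  available s := by
    rw [Kernel.deterministic_apply, ae_dirac_eq]
    exact hav s

/-- Each pair determines the next with probability one, and countably many null sets are discarded.
-/
theorem Env.Policy.ae_deterministic_eq {f : State V k → Action V k} (hf : Measurable f)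
    (hav : ∀ s, f s ∈ M.actions τmax s) {s : State V k} {ξ₀ : ℕ → State V k × Action V k}
    (h0 : (ξ₀ 0).1 = s) (hstep : ∀ n, (ξ₀ (n + 1)).1 = M.step T (ξ₀ n).1 (ξ₀ n).2)
    (hξ : ∀ n, (ξ₀ n).2 = f (ξ₀ n).1) :
    ∀ᵐ ξ ∂((Env.Policy.deterministic M f hf hav).law T s), ξ = ξ₀ := by
  have hker : ∀ s, ∀ᵐ a ∂((Env.Policy.deterministic M f hf hav).kernel s), a = f s := fun s => by
    change ∀ᵐ a ∂(Kernel.deterministic f hf s), a = f s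
    rw [Kernel.deterministic_apply, ae_dirac_eq]
    exact rfl
  have h0' := (Env.Policy.deterministic M f hf hav).ae_law_zero T (s := s)
    (P := fun x => x = ξ₀ 0) (measurableSet_singleton _)
    ((hker s).mono fun a ha => Prod.ext h0.symm (by rw [ha, hξ, h0]))
  have h1 := fun n => (Env.Policy.deterministic M f hf hav).ae_law_succ T s
    (P := fun x => x.1 = ξ₀ n → x.2 = ξ₀ (n + 1))
    ((measurable_fst (measurableSet_singleton (ξ₀ n))).imp
      (measurable_snd (measurableSet_singleton (ξ₀ (n + 1)))))
    (fun x => (hker _).mono fun a ha (hx : x = ξ₀ n) => Prod.ext (by rw [hstep, ← hx])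
      (by rw [hξ, hstep, ← hx]; exact ha)) n
  filter_upwards [h0', ae_all_iff.2 h1] with ξ h0' h1
  funext n
  induction n with
  | zero => exact h0'
  | succ n ih => exact h1 n ih

end Law

/-! ## Stationary policies from trajectories -/

section Stationary

variable {V : Type*} [MeasurableSpace V] [Finite V] [DiscreteMeasurableSpace V] {M : Env V}
  {k : ℕ} {τmax T : ℝ}

open Classical in
/-- Every available robot waits. -/
noncomputable def waitAction (τmax : ℝ) (s : State V k) : Action V k := fun r =>
  if (s.pos r).2.2 = 0 then Sum.inr ((s.pos r).2.1, τmax) else Sum.inl ()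

omit [Finite V] [DiscreteMeasurableSpace V] in
theorem measurable_waitAction (τmax : ℝ) :
    Measurable (waitAction τmax : State V k → Action V k) := by
  refine measurable_pi_lambda _ fun r => ?_
  have hp : Measurable fun s : State V k => s.pos r := by unfold State.pos; fun_prop
  exact Measurable.ite (hp.snd.snd (measurableSet_singleton 0))
    (measurable_inr.comp (hp.snd.fst.prodMk measurable_const)) measurable_const

omit [MeasurableSpace V] [Finite V] [DiscreteMeasurableSpace V] in
theorem waitAction_mem (hτ : 0 < τmax) (s : State V k) : waitAction τmax s ∈ M.actions τmax s := by
  intro r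
  unfold waitAction
  split_ifs with h
  · exact Or.inl ⟨h, _, _, rfl, Or.inr ⟨rfl, hτ, le_rfl⟩⟩
  · exact Or.inr ⟨h, rfl⟩

/-- Every trajectory can be replaced by a trajectory of a stationary deterministic policy which
visits no other states. -/
theorem Env.IsTrajectory.exists_stationary (hk : 0 < k) (hτ : 0 < τmax) {p₀ : Fin k → V}
    {ξ : ℕ → State V k × Action V k} (h : M.IsTrajectory τmax T p₀ ξ)
    (hlim : Tendsto (eventTime T ξ) atTop atTop) :
    ∃ f : State V k → Action V k, Measurable f ∧ (∀ s, f s ∈ M.actions τmax s) ∧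
      ∃ ξ' : ℕ → State V k × Action V k, M.IsTrajectory τmax T p₀ ξ' ∧
        (∀ n, (ξ' n).2 = f (ξ' n).1) ∧ Tendsto (eventTime T ξ') atTop atTop ∧
        ∀ n, ∃ m, ξ' n = ξ m := by
  classical
  -- The index of the first occurrence of a state; the action taken there is used on every return,
  -- so that it depends on the state only.
  let first : ℕ → ℕ := fun n => Nat.find (p := fun m => (ξ m).1 = (ξ n).1) ⟨n, rfl⟩
  have hfirst : ∀ n, (ξ (first n)).1 = (ξ n).1 := fun n =>
    Nat.find_spec (p := fun m => (ξ m).1 = (ξ n).1) ⟨n, rfl⟩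
  have hfirst_le : ∀ n m, (ξ m).1 = (ξ n).1 → first n ≤ m := fun n m hm => Nat.find_min' _ hm
  have hcongr : ∀ n m, (ξ m).1 = (ξ n).1 → first n = first m := fun n m hm =>
    le_antisymm (hfirst_le n _ ((hfirst m).trans hm)) (hfirst_le m _ ((hfirst n).trans hm.symm))
  let f : State V k → Action V k := fun s =>
    if hs : ∃ n, (ξ n).1 = s then (ξ (first hs.choose)).2 else waitAction τmax s
  have hf : ∀ n, f (ξ n).1 = (ξ (first n)).2 := fun n => by
    have hs : ∃ m, (ξ m).1 = (ξ n).1 := ⟨n, rfl⟩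
    simp only [f, dif_pos hs]
    rw [← hcongr n _ hs.choose_spec]
  have hfm : Measurable f := by
    -- The policy differs from waiting only in the countably many states of the trajectory.
    refine (measurable_waitAction τmax).measurable_of_countable_ne
      ((Set.countable_range fun n => (ξ n).1).mono fun s hs => ?_)
    by_contra hns
    exact hs (by simp only [f]; rw [dif_neg fun ⟨n, hn⟩ => hns ⟨n, hn⟩])
  have hfav : ∀ s, f s ∈ M.actions τmax s := fun s => by
    by_cases hs : ∃ n, (ξ n).1 = s
    · obtain ⟨n, rfl⟩ := hs
      rw [hf, ← hfirst]
      exact h.available _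
    · simp only [f]
      rw [dif_neg hs]
      exact waitAction_mem hτ s
  -- The indices followed by the new policy: after each step it falls back to the first occurrence
  -- of the state reached.
  let i : ℕ → ℕ := fun n => (fun m => first (m + 1))^[n] 0
  have hi_succ : ∀ n, i (n + 1) = first (i n + 1) := fun n => Function.iterate_succ_apply' _ _ _
  have hi : ∀ n, first (i n) = i n := fun n => by
    cases n with
    | zero => exact Nat.le_zero.1 (hfirst_le 0 0 rfl)
    | succ n => rw [hi_succ]; exact hcongr _ _ (hfirst _).symm
  have hξ' : M.IsTrajectory τmax T p₀ fun n => ξ (i n) :=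
    ⟨h.init, fun n => h.available _, fun n => by rw [hi_succ, hfirst, h.step]⟩
  refine ⟨f, hfm, hfav, fun n => ξ (i n), hξ', fun n => by rw [hf, hi], ?_, fun n => ⟨i n, rfl⟩⟩
  by_cases hinj : Function.Injective fun n => (ξ n).1
  · have hid : ∀ n, i n = n := fun n => by
      induction n with
      | zero => rfl
      | succ n ih => rw [hi_succ, ih]; exact hinj (hfirst _)
    simpa only [hid] using hlim
  · obtain ⟨a, b, hab, hne⟩ : ∃ a b, (ξ a).1 = (ξ b).1 ∧ a < b := by
      simp only [Function.Injective, not_forall] at hinj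
      obtain ⟨a, b, hab, hne⟩ := hinj
      rcases Ne.lt_or_gt hne with hlt | hlt
      exacts [⟨a, b, hab, hlt⟩, ⟨b, a, hab.symm, hlt⟩]
    -- The state at `b` occurred already at `a < b`, so a walk about to reach `b` falls back to at
    -- most `a`. Only finitely many durations then occur, and these have a positive lower bound.
    have hib : ∀ n, i n < b := fun n => by
      induction n with
      | zero => exact (Nat.zero_le a).trans_lt hne
      | succ n ih =>
        rw [hi_succ]
        rcases (Nat.succ_le_iff.2 ih).lt_or_eq with hlt | heq
        · exact (hfirst_le _ _ rfl).trans_lt hlt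
        · refine (hfirst_le _ a ?_).trans_lt hne
          rw [hab, ← heq]
    obtain ⟨ε, hε, hlt⟩ := Pi.exists_forall_pos_add_lt (x := fun _ : Fin b => (0 : ℝ))
      (y := fun m => duration T (ξ m).1 (ξ m).2) fun m => h.duration_pos hk m
    refine tendsto_atTop_mono (f := fun n : ℕ => n * ε) (fun n => ?_)
      (tendsto_natCast_atTop_atTop.atTop_mul_const hε)
    unfold eventTime
    rw [← nsmul_eq_mul]
    simpa using Finset.card_nsmul_le_sum (Finset.range n) _ ε fun m _ => by
      have := hlt ⟨i m, hib m⟩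
      rw [zero_add] at this
      exact this.le

theorem Env.IsTrajectory.exists_policy (hk : 0 < k) (hτ : 0 < τmax) (hT : 0 < T)
    {p₀ : Fin k → V} {ξ : ℕ → State V k × Action V k} (h : M.IsTrajectory τmax T p₀ ξ)
    (hlim : Tendsto (eventTime T ξ) atTop atTop) {c : ℝ} (hc : ∀ n, (ξ n).1.tracker ≤ c) :
    ∃ μ ∈ M.admissible τmax T (initState p₀),
      μ.averageReward T (initState p₀) ≤ ENNReal.ofReal c := by
  obtain ⟨f, hf, hav, ξ', hξ', hfξ, hlim', hsub⟩ := h.exists_stationary hk hτ hlim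
  have hae := Env.Policy.ae_deterministic_eq hf hav hξ'.init hξ'.step hfξ
  have : IsProbabilityMeasure ((Env.Policy.deterministic M f hf hav).law T (initState p₀)) := by
    have := (Env.Policy.deterministic M f hf hav).isMarkov
    unfold Env.Policy.law
    infer_instance
  refine ⟨Env.Policy.deterministic M f hf hav, hae.mono fun ζ hζ => by rwa [hζ], ?_⟩
  rw [Env.Policy.averageReward_eq _ hk hT]
  calc _ ≤ ∫⁻ _, ENNReal.ofReal c
        ∂((Env.Policy.deterministic M f hf hav).law T (initState p₀)) := by
        refine lintegral_mono_ae (hae.mono fun ζ hζ => iSup_le fun n => ?_)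
        obtain ⟨m, hm⟩ := hsub n
        rw [hζ, hm]
        exact ENNReal.ofReal_le_ofReal (hc m)
    _ = _ := by simp

end Stationary

/-! ## Optimality -/

section Optimality

variable {V : Type*} [MeasurableSpace V] [Finite V] [DiscreteMeasurableSpace V] {M : Env V}
  {k : ℕ} {τmax T : ℝ}

theorem Env.exists_optimal_policy (hc : M.graph.Connected) (hk : 0 < k) (p₀ : Fin k → V)
    (hτ : 0 < τmax) (hfin : M.optimalTailLatency k T ≠ ∞)
    (hT : M.diameter + (M.optimalTailLatency k T).toReal / M.minWeight < T) :
    ∃ μ ∈ M.admissible τmax T (initState p₀),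
      μ.averageReward T (initState p₀) ≤ M.optimalTailLatency k T := by
  have := hc.nonempty
  have hJ0 : 0 ≤ (M.optimalTailLatency k T).toReal := ENNReal.toReal_nonneg
  have hD : 0 ≤ M.diameter := Real.iSup_nonneg fun q => M.pathDist_nonneg _ _
  have hT0 : 0 < T :=
    lt_of_le_of_lt (add_nonneg hD (div_nonneg hJ0 M.minWeight_pos.le)) hT
  obtain ⟨σ, hσ, T', hT', hvis⟩ := M.exists_optimal_schedules hc p₀ hτ hfin hT
  obtain ⟨ξ, hξ, hlim, hat⟩ := M.exists_isTrajectory hk hT0 σ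
  simp only [hσ] at hξ
  have htr := hξ.tracker_le hk hT0 hT' hJ0 fun t ht v => by
    obtain ⟨r, t', h1, h2, h3⟩ := hvis t ht v
    have h4 := M.le_lastVisit _ h2 (hat v r t' h3)
    rw [← NNReal.coe_le_coe] at h4
    rw [mul_comm, ← le_div_iff₀ (M.weight_pos v), Env.latency]
    linarith
  obtain ⟨μ, hμ, hle⟩ := hξ.exists_policy hk hτ hT0 hlim htr
  exact ⟨μ, hμ, by rwa [ENNReal.ofReal_toReal hfin] at hle⟩

theorem Env.Policy.ae_optimal_le (hc : M.graph.Connected) (hk : 0 < k) (hT : 0 < T)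
    {p₀ : Fin k → V} {μ : M.Policy k τmax} (hμ : μ ∈ M.admissible τmax T (initState p₀)) :
    ∀ᵐ ξ ∂(μ.law T (initState p₀)), M.trajectoryStrategy T ξ ∈ M.feasible k ∧
      (∀ r, M.trajectoryStrategy T ξ 0 r = M.node (p₀ r)) ∧
      M.optimalTailLatency k T ≤ M.tailLatency T (M.trajectoryStrategy T ξ) ∧
      M.tailLatency T (M.trajectoryStrategy T ξ) ≤ ⨆ n, ENNReal.ofReal (ξ n).1.tracker := by
  filter_upwards [μ.ae_isTrajectory T p₀, hμ] with ξ h hlim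
  have hf := h.feasible hc hk hlim
  exact ⟨hf, h.strategy_zero hk, iInf₂_le _ hf, h.tailLatency_le hc hk hT hlim⟩

theorem Env.Policy.optimalTailLatency_le_averageReward (hc : M.graph.Connected) (hk : 0 < k)
    (hT : 0 < T) {p₀ : Fin k → V} {μ : M.Policy k τmax}
    (hμ : μ ∈ M.admissible τmax T (initState p₀)) :
    M.optimalTailLatency k T ≤ μ.averageReward T (initState p₀) := by
  have : IsProbabilityMeasure (μ.law T (initState p₀)) := by
    have := μ.isMarkov
    unfold Env.Policy.law
    infer_instance
  rw [μ.averageReward_eq hk hT]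
  calc M.optimalTailLatency k T
      = ∫⁻ _, M.optimalTailLatency k T ∂(μ.law T (initState p₀)) := by simp
    _ ≤ _ := lintegral_mono_ae ((ae_optimal_le hc hk hT hμ).mono
      fun ξ h => h.2.2.1.trans h.2.2.2)

/-- A function that is almost surely at least a finite constant and has that constant as its mean
equals it almost surely; here the function is the supremum of the tracker. -/
theorem Env.Policy.ae_tailLatency_eq (hc : M.graph.Connected) (hk : 0 < k) (hT : 0 < T)
    (hfin : M.optimalTailLatency k T ≠ ∞) {p₀ : Fin k → V} {μ : M.Policy k τmax}
    (hμ : μ ∈ M.admissible τmax T (initState p₀))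
    (hopt : μ.averageReward T (initState p₀) = M.optimalTailLatency k T) :
    ∀ᵐ ξ ∂(μ.law T (initState p₀)), M.trajectoryStrategy T ξ ∈ M.feasible k ∧
      (∀ r, M.trajectoryStrategy T ξ 0 r = M.node (p₀ r)) ∧
      M.tailLatency T (M.trajectoryStrategy T ξ) = M.optimalTailLatency k T := by
  have : IsProbabilityMeasure (μ.law T (initState p₀)) := by
    have := μ.isMarkov
    unfold Env.Policy.law
    infer_instance
  rw [μ.averageReward_eq hk hT] at hopt
  have hle := ae_optimal_le hc hk hT hμ
  have heq := ae_eq_of_ae_le_of_lintegral_le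
    (hle.mono fun ξ h => h.2.2.1.trans h.2.2.2) (by simpa using hfin)
    (Measurable.iSup measurable_tracker).aemeasurable (by simpa using hopt.le)
  filter_upwards [hle, heq] with ξ h1 h2
  exact ⟨h1.1, h1.2.1, le_antisymm (h1.2.2.2.trans h2.ge) h1.2.2.1⟩

end Optimality

end Monitoring

open Monitoring
theorem mainTheorem1 {V : Type*} [Finite V] [MeasurableSpace V] [DiscreteMeasurableSpace V]
    (M : Env V) (hconn : M.graph.Connected) {k : ℕ} (hk : 0 < k) (p₀ : Fin k → V)
    (τmax : ℝ) (hτ : 0 < τmax) (T : ℝ)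
    (hT : ENNReal.ofReal M.diameter + M.optimalTailLatency k T / ENNReal.ofReal M.minWeight
      < ENNReal.ofReal T) :
    (∀ μ ∈ M.admissible τmax T (initState p₀),
      Tendsto (μ.meanReward T (initState p₀)) atTop (𝓝 (μ.averageReward T (initState p₀)))) ∧
    (∃ μ ∈ M.admissible τmax T (initState p₀),
      μ.averageReward T (initState p₀) =
        ⨅ ν ∈ M.admissible τmax T (initState p₀), ν.averageReward T (initState p₀)) ∧
    (⨅ ν ∈ M.admissible τmax T (initState p₀), ν.averageReward T (initState p₀)) =
      M.optimalTailLatency k T ∧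
    (∀ μ ∈ M.admissible τmax T (initState p₀),
      μ.averageReward T (initState p₀) =
        (⨅ ν ∈ M.admissible τmax T (initState p₀), ν.averageReward T (initState p₀)) →
      ∀ᵐ ξ ∂(μ.law T (initState p₀)),
        M.trajectoryStrategy T ξ ∈ M.feasible k ∧
        (∀ r, M.trajectoryStrategy T ξ 0 r = M.node (p₀ r)) ∧
        M.tailLatency T (M.trajectoryStrategy T ξ) = M.optimalTailLatency k T) := by
  have := hconn.nonempty
  have hφ := M.minWeight_pos
  have hD : 0 ≤ M.diameter := Real.iSup_nonneg fun q => M.pathDist_nonneg _ _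
  have hT0 : 0 < T := ENNReal.ofReal_pos.1 (pos_of_gt hT)
  have hfin : M.optimalTailLatency k T ≠ ∞ := by
    intro h
    rw [h, ENNReal.top_div_of_ne_top ENNReal.ofReal_ne_top, add_top] at hT
    exact not_top_lt hT
  have hT' : M.diameter + (M.optimalTailLatency k T).toReal / M.minWeight < T := by
    rw [← ENNReal.ofReal_toReal hfin, ← ENNReal.ofReal_div_of_pos hφ,
      ← ENNReal.ofReal_add hD (div_nonneg ENNReal.toReal_nonneg hφ.le)] at hT
    exact (ENNReal.ofReal_lt_ofReal_iff hT0).1 hT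
  obtain ⟨μ₀, hμ₀, hle⟩ := M.exists_optimal_policy (τmax := τmax) hconn hk p₀ hτ hfin hT'
  have hinf : (⨅ ν ∈ M.admissible τmax T (initState p₀), ν.averageReward T (initState p₀)) =
      M.optimalTailLatency k T :=
    le_antisymm ((iInf₂_le μ₀ hμ₀).trans hle)
      (le_iInf₂ fun ν hν => ν.optimalTailLatency_le_averageReward hconn hk hT0 hν)
  refine ⟨fun μ _ => ?_, ⟨μ₀, hμ₀, ?_⟩, hinf, fun μ hμ hopt => ?_⟩
  · rw [μ.averageReward_eq hk hT0]
    exact μ.tendsto_meanReward hk hT0 p₀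
  · rw [hinf]
    exact le_antisymm hle (μ₀.optimalTailLatency_le_averageReward hconn hk hT0 hμ₀)
  · exact Env.Policy.ae_tailLatency_eq hconn hk hT0 hfin hμ (hopt.trans hinf)
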